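/- **Setting.** Let $\mathcal X\subset\mathbb R^{p}$ be compact with $\mathcal X=\overline{\operatorname{int}\mathcal X}$, $\mathcal Y\subset\mathbb R$, and let $(x_1,y_1),\dots,(x_n,y_n)$ be independent copies of a random pair $(x,y)\in\mathcal X\times\mathcal Y$ with $E|y|<\infty$; $\rho_x$ is the law of $x$. Let $L:\mathcal Y\times\mathbb R\to[0,\infty)$ be a loss function, measurable in its first argument, such that 1. $L(y,\cdot)$ is convex and $L(y,\omega)\le c_1(|y|^q+|\omega|^q)$ for all $y\in\mathcal Y$, $\omega\in\mathbb R$, where $c_1>0$ and $q\ge1$; 2. for every $R\ge0$ there is $c_2(R)>0$ with $|L(y,\omega)-L(y,\omega')|\le c_2(R)|\omega-\omega'|$ for all $\omega,\omega'\in[-R,R]$ and $y\in\mathcal Y$. Let $\mathcal H_K$ be the reproducing kernel Hilbert space of a kernel $K$ on $\mathcal X$, with norm $\|\cdot\|_K$, such that every section $K(\cdot,y)$ is $C^1$ on $\mathcal X$ (continuous on $\mathcal X$, with first partial derivatives in $\operatorname{int}\mathcal X$ that extend continuously to $\mathcal X$; at points of the boundary the partial derivative means this extension). Put $K_x=K(x,\cdot)$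 and $\partial_lK_x=\partial K(x,\cdot)/\partial x^l$. *Assumption 1.* $\|K_x\|_K\le\kappa_1$, and $\partial_lK_x\in\mathcal H_K$ with $\|\partial_lK_x\|_K\le\kappa_2$, for all $x\in\mathcal X$ and $l=1,\dots,p$, where $\kappa_1,\kappa_2>0$. Let $f^*\in\mathcal H_K$ be the minimizer over $\mathcal H_K$ of the expected loss $\mathcal E^L(f)=E\,L(y,f(x))$ (assumed finite at $f^*$) that has the smallest norm among all minimizers. For $\lambda>0$ let $\tilde f$ be the minimizer over $\mathcal H_K$ of $\mathcal E^L(f)+\lambda\|f\|_K^2$, and $\hat f$ the minimizer over $\mathcal H_K$ of $\frac1n\sum_{i=1}^nL(y_i,f(x_i))+\lambda\|f\|_K^2$. *Assumption 2.* $\|\tilde f-f^*\|_K=c_3\lambda^\theta$, where $c_3,\theta>0$. Let $g_l^*=\partial f^*/\partial x^l$, $\hat g_l=\partial\hat f/\partial x^l$, $\|g\|_2^2=\int g^2\,d\rho_x$ and $\|g\|_n^2=\frac1n\sum_{i=1}^ng(x_i)^2$. All objects, including the dimension $p=p_n$, may change with $n$, while the constants $q,c_1,c_2(\cdot),\kappa_1,\kappa_2,c_3,\theta$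 and $E|y|$ do not and $\|f^*\|_K$ stays bounded, $\|f^*\|_K\le B$. **Theorem 1.** Let Assumptions 1 and 2 hold with $\lambda=\lambda_n=n^{-1/(4q)}$. There is a constant $c_4>0$, depending only on $q,c_1,c_2(\cdot),\kappa_1,\kappa_2,c_3,\theta,B$ and $E|y|$, such that for every $n\ge2$ and every $\delta_n\ge2(\log n)^{-1/q}E|y|$, with probability at least $1-\delta_n$, $$\max_{l=1,\dots,p_n}\Big|\|\hat g_l\|_n^2-\|g_l^*\|_2^2\Big|\le c_4\Big(\log\frac{4p_n}{\delta_n}\Big)^{1/2}\max\Big\{(\log n)^{q/2}n^{-3/16},\;n^{-\theta/(4q)}\Big\}.$$ -/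

import Mathlib

open MeasureTheory Topology

noncomputable section

namespace SparseRKHS

/-- The space of covariates: `ℝ^p` with its Euclidean structure. -/
abbrev E (p : ℕ) : Type := EuclideanSpace ℝ (Fin p)

section Derivatives

variable {p : ℕ} {X : Set (E p)}

/-- The `l`-th partial derivative, at a point `z` of the ambient space, of a function on `X`
(meaningful for `z` in the interior of `X`; the function is extended by zero off `X`). -/
def innerPartial (l : Fin p) (f : X → ℝ) (z : E p) : ℝ :=
  lineDeriv ℝ (Function.extend Subtype.val f 0) z (EuclideanSpace.single l (1 : ℝ))

/-- The `l`-th partial derivative `∂f/∂x^l` of a function on `X`: the classical partial derivative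
in the interior of `X`, extended to `X` by limits taken from the interior. -/
def partialDeriv (l : Fin p) (f : X → ℝ) (x : X) : ℝ :=
  extendFrom (interior X) (innerPartial l f) (x : E p)

/-- `f ∈ C¹(X)`: `f` is continuous on `X`, its partial derivatives exist in the interior of `X`
and they extend to continuous functions on `X`. -/
def IsC1 (f : X → ℝ) : Prop :=
  Continuous f ∧ ∀ l : Fin p, ∃ g : E p → ℝ, ContinuousOn g X ∧
    ∀ z ∈ interior X, HasLineDerivAt ℝ (Function.extend Subtype.val f 0) (g z) z
      (EuclideanSpace.single l (1 : ℝ))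

end Derivatives

section Loss

variable {Y : Set ℝ}

/-- The conditions on a loss function `L : Y × ℝ → [0, ∞)`: it is measurable in the response,
convex in the prediction, of polynomial growth of order `q` with constant `c₁`, and locally
Lipschitz in the prediction with constant `c₂ R` on `[-R, R]`, uniformly in the response. -/
structure LossConditions (q c₁ : ℝ) (c₂ : ℝ → ℝ) (L : Y → ℝ → ℝ) : Prop where
  nonneg : ∀ y w, 0 ≤ L y w
  measurable : ∀ w, Measurable fun y => L y w
  convex : ∀ y, ConvexOn ℝ Set.univ (L y)
  growth : ∀ (y : Y) (w : ℝ), L y w ≤ c₁ * (|(y : ℝ)| ^ q + |w| ^ q)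
  lipschitz : ∀ R : ℝ, 0 ≤ R → ∀ y, ∀ w ∈ Set.Icc (-R) R, ∀ w' ∈ Set.Icc (-R) R,
    |L y w - L y w'| ≤ c₂ R * |w - w'|

end Loss

section Estimation

variable {p : ℕ} {X : Set (E p)} {Y : Set ℝ}
variable {H : Type*} [NormedAddCommGroup H] [InnerProductSpace ℝ H]
variable [RKHS ℝ H X ℝ]

variable (H) in
/-- The section `K_x = K(x, ·) ∈ H` of the reproducing kernel `K` of `H`. -/
def kerSection [CompleteSpace H] (x : X) : H := RKHS.kerFun H x (1 : ℝ)

variable (H) in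
/-- Boundedness of the kernel and of its partial derivatives: `‖K_x‖ ≤ κ₁` for all `x ∈ X`, and
for all `l` and `x ∈ X` the function `∂_l K_x : y ↦ ∂K(x, y)/∂x^l` belongs to `H`
and `‖∂_l K_x‖ ≤ κ₂`. -/
structure KernelBounds [CompleteSpace H] (κ₁ κ₂ : ℝ) : Prop where
  kernel : ∀ x : X, ‖kerSection H x‖ ≤ κ₁
  derivative : ∀ (l : Fin p) (x : X), ∃ D : H,
    (∀ y : X, D y = partialDeriv l (fun x' : X => kerSection H y x') x) ∧ ‖D‖ ≤ κ₂

/-- The expected loss `E L(y, f(x))`, as an extended nonnegative number. -/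
def risk (P : Measure (X × Y)) (L : Y → ℝ → ℝ) (f : H) : ENNReal :=
  ∫⁻ z, ENNReal.ofReal (L z.2 (f z.1)) ∂P

/-- `f` is a minimizer of the expected loss over `H`, with finite expected loss. -/
def IsRiskMinimizer (P : Measure (X × Y)) (L : Y → ℝ → ℝ) (f : H) : Prop :=
  risk P L f ≠ ⊤ ∧ ∀ h : H, risk P L f ≤ risk P L h

/-- `f` is the target function: the minimizer of the expected loss of the smallest norm. -/
def IsTarget (P : Measure (X × Y)) (L : Y → ℝ → ℝ) (f : H) : Prop :=
  IsRiskMinimizer P L f ∧ ∀ h : H, IsRiskMinimizer P L h → ‖f‖ ≤ ‖h‖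

/-- `f` minimizes the regularized expected loss `E L(y, f(x)) + lam ‖f‖²` over `H`. -/
def IsRegRiskMinimizer (P : Measure (X × Y)) (L : Y → ℝ → ℝ) (lam : ℝ) (f : H) : Prop :=
  ∀ h : H, risk P L f + ENNReal.ofReal (lam * ‖f‖ ^ 2) ≤
    risk P L h + ENNReal.ofReal (lam * ‖h‖ ^ 2)

/-- `f` is the regularized M-estimator on the sample `z`: it minimizes
`(1/n) ∑ L(y_i, f(x_i)) + lam ‖f‖²` over `H`. -/
def IsMEstimator {n : ℕ} (L : Y → ℝ → ℝ) (lam : ℝ) (z : Fin n → X × Y) (f : H) : Prop :=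
  ∀ h : H, (1 / (n : ℝ)) * ∑ i, L (z i).2 (f (z i).1) + lam * ‖f‖ ^ 2 ≤
    (1 / (n : ℝ)) * ∑ i, L (z i).2 (h (z i).1) + lam * ‖h‖ ^ 2

end Estimation

section GradientNorms

variable {p : ℕ} {X : Set (E p)} {Y : Set ℝ}

/-- The squared empirical norm `(1/n) ∑ (g(x_i))²` of a function on the covariates. -/
def empNormSq {n : ℕ} (z : Fin n → X × Y) (g : X → ℝ) : ℝ :=
  (1 / (n : ℝ)) * ∑ i, g (z i).1 ^ 2

/-- The squared `L²` norm of a function under the marginal law of the covariates. -/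
def popNormSq (P : Measure (X × Y)) (g : X → ℝ) : ℝ :=
  ∫ x, g x ^ 2 ∂P.fst

end GradientNorms

end SparseRKHS

end

/-! Differentiation at a point is a bounded functional on `H`, represented by `∂_l K_x` of norm at
most `κ₂` (`KernelBounds.partialDeriv_eq_inner`). Hence replacing `fhat` by `fstar` changes every
empirical gradient norm by at most `κ₂ ^ 2 * ‖fhat - fstar‖ * (‖fhat‖ + ‖fstar‖)`, uniformly in `l`.
For the fixed function `fstar`, Hoeffding's inequality and a union bound over `l` compare empirical
and population norms; this is where `log (4 p / δ)` comes from.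

Since `‖ftilde - fstar‖` is the given bias, `‖fhat - ftilde‖` remains. The first order condition for
`ftilde` reads `-2 lam ftilde = E u(x, y) K_x` with `u` a measurable subgradient of the loss.
Comparing `fhat` with `ftilde` in the empirical problem, the quadratic penalty bounds `lam * ‖fhat -
ftilde‖` by the norm of the mean of the centred vectors `u K_x + 2 lam ftilde`, and Chebyshev's
inequality in `H` gives `‖fhat - ftilde‖ ^ 2 ≲ 1 / (n δ lam ^ 2)` (`measure_norm_sub_sq_ge_le`). The
choice of `lam` and the lower bound on `δ` turn this into the rate `n ^ (-3/16)`.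

As the loss need not be differentiable, `u` is obtained only approximately: between difference
quotients of a small step `ε`, by Hahn–Banach in `L²` (`exists_selection_of_le_integral_max`). The
estimator is not assumed measurable; its failure event is only included in a measurable one. -/

namespace SparseRKHS

/-! ### Regularity of functions in the RKHS and representers of derivatives -/

section KernelSections

variable {p : ℕ} {X : Set (E p)}
variable {H : Type*} [NormedAddCommGroup H] [InnerProductSpace ℝ H] [CompleteSpace H]
variable [RKHS ℝ H X ℝ]

lemma inner_kerSection (x : X) (f : H) : inner ℝ (kerSection H x) f = f x := by
  simp [kerSection]

/-- The kernel sections span a dense subspace. This transfers continuity and differentiability from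
the sections to all of `H`. -/
lemma mem_of_forall_kerSection_mem (M : Submodule ℝ H) (hM : IsClosed (M : Set H))
    (h : ∀ x : X, kerSection H x ∈ M) (f : H) : f ∈ M := by
  have hle : Submodule.span ℝ {g : H | ∃ (x : X) (v : ℝ), RKHS.kerFun H x v = g} ≤ M := by
    rw [Submodule.span_le]
    rintro _ ⟨x, v, rfl⟩
    have : RKHS.kerFun H x v = v • kerSection H x := by
      rw [kerSection, ← map_smul]; simp
    rw [this]
    exact M.smul_mem v (h x)
  have := Submodule.topologicalClosure_minimal _ hle hM
  have htop := RKHS.kerFun_dense (𝕜 := ℝ) H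
  rw [htop] at this
  exact this trivial

variable {κ₁ κ₂ : ℝ}

lemma KernelBounds.abs_apply_le (hK : KernelBounds H κ₁ κ₂) (f : H) (x : X) :
    |f x| ≤ κ₁ * ‖f‖ := by
  rw [← inner_kerSection]
  exact (abs_real_inner_le_norm _ _).trans
    (mul_le_mul_of_nonneg_right (hK.kernel x) (norm_nonneg _))

/-- If `F : X → H` is bounded, the vectors `f` with `x ↦ ⟪F x, f⟫` continuous form a closed
subspace; so it suffices to test the continuity on the kernel sections. -/
lemma continuous_inner_of_forall_kerSection {F : X → H} {κ : ℝ} (hF : ∀ x, ‖F x‖ ≤ κ)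
    (h : ∀ y : X, Continuous fun x => inner ℝ (F x) (kerSection H y)) (f : H) :
    Continuous fun x => inner ℝ (F x) f := by
  let M : Submodule ℝ H :=
    { carrier := {f | Continuous fun x => inner ℝ (F x) f}
      add_mem' := fun {a b} ha hb => by
        simp only [Set.mem_ofPred_eq, inner_add_right] at *
        exact ha.add hb
      zero_mem' := by simp [continuous_const]
      smul_mem' := fun c a ha => by
        simp only [Set.mem_ofPred_eq, inner_smul_right] at *
        exact ha.const_mul c }
  refine mem_of_forall_kerSection_mem M ?_ h f
  refine IsSeqClosed.isClosed fun g f hg hgf => ?_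
  have hu : TendstoUniformly (fun k x => inner ℝ (F x) (g k)) (fun x => inner ℝ (F x) f)
      Filter.atTop := by
    rw [Metric.tendstoUniformly_iff]
    intro ε hε
    have h0 := (tendsto_iff_norm_sub_tendsto_zero.mp hgf).const_mul κ
    rw [mul_zero] at h0
    filter_upwards [h0.eventually (gt_mem_nhds hε)] with k hk x
    rw [dist_comm, Real.dist_eq, ← inner_sub_right]
    exact ((abs_real_inner_le_norm _ _).trans
      (mul_le_mul_of_nonneg_right (hF x) (norm_nonneg _))).trans_lt hk
  exact hu.continuous (Filter.Frequently.of_forall hg)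

lemma KernelBounds.continuous_coe (hK : KernelBounds H κ₁ κ₂)
    (hC : ∀ y : X, IsC1 (fun x : X => kerSection H y x)) (f : H) : Continuous (f : X → ℝ) := by
  have := continuous_inner_of_forall_kerSection (F := fun x : X => kerSection H x) hK.kernel
    (fun y => by simpa only [inner_kerSection] using (hC y).1) f
  simpa only [inner_kerSection] using this

lemma extend_add (f g : X → ℝ) (z : E p) :
    Function.extend Subtype.val (f + g) 0 z =
      Function.extend Subtype.val f 0 z + Function.extend Subtype.val g 0 z := by
  by_cases hz : z ∈ X
  · lift z to X using hz
    simp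
  · have : ¬ ∃ a : X, (a : E p) = z := by simpa using hz
    simp [Function.extend_apply' _ _ _ this]

lemma extend_smul (c : ℝ) (f : X → ℝ) (z : E p) :
    Function.extend Subtype.val (c • f) 0 z = c * Function.extend Subtype.val f 0 z := by
  by_cases hz : z ∈ X
  · lift z to X using hz
    simp
  · have : ¬ ∃ a : X, (a : E p) = z := by simpa using hz
    simp [Function.extend_apply' _ _ _ this]

/-- On the interior and, by extension, on `X`, the partial derivative of a `C¹` function is the
continuous function that the definition provides. -/
lemma partialDeriv_eq_of_hasLineDerivAt (hX : X ⊆ closure (interior X)) {l : Fin p} {f : X → ℝ}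
    {g : X → ℝ} (hg : Continuous g)
    (h : ∀ x : X, (x : E p) ∈ interior X → HasLineDerivAt ℝ (Function.extend Subtype.val f 0)
      (g x) x (EuclideanSpace.single l (1 : ℝ))) (x : X) :
    partialDeriv l f x = g x := by
  refine extendFrom_eq (hX x.2) ?_
  have h1 : Filter.Tendsto (Function.extend Subtype.val g 0) (𝓝[X] (x : E p)) (𝓝 (g x)) := by
    rw [nhdsWithin_eq_map_subtype_coe x.2, Filter.tendsto_map'_iff]
    have : (Function.extend Subtype.val g 0 ∘ Subtype.val : X → ℝ) = g := by
      ext y; simp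
    rw [this]
    exact hg.tendsto x
  refine (h1.mono_left (nhdsWithin_mono _ interior_subset)).congr' ?_
  filter_upwards [self_mem_nhdsWithin] with z hz
  have := h ⟨z, interior_subset hz⟩ hz
  rw [innerPartial, this.lineDeriv]
  exact Subtype.val_injective.extend_apply g 0 ⟨z, interior_subset hz⟩

/-- The representer `∂_l K_x` of the `l`-th partial derivative at `x`. -/
noncomputable def KernelBounds.derivSection (hK : KernelBounds H κ₁ κ₂) (l : Fin p) (x : X) : H :=
  (hK.derivative l x).choose

lemma KernelBounds.inner_derivSection_kerSection (hK : KernelBounds H κ₁ κ₂) (l : Fin p)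
    (x y : X) : inner ℝ (hK.derivSection l x) (kerSection H y) =
      partialDeriv l (fun x' : X => kerSection H y x') x := by
  rw [real_inner_comm, inner_kerSection]
  exact (hK.derivative l x).choose_spec.1 y

lemma KernelBounds.norm_derivSection_le (hK : KernelBounds H κ₁ κ₂) (l : Fin p) (x : X) :
    ‖hK.derivSection l x‖ ≤ κ₂ :=
  (hK.derivative l x).choose_spec.2

lemma IsC1.hasLineDerivAt_partialDeriv (hX : X ⊆ closure (interior X)) {f : X → ℝ} (hf : IsC1 f)
    (l : Fin p) : Continuous (partialDeriv l f) ∧ ∀ x : X, (x : E p) ∈ interior X →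
      HasLineDerivAt ℝ (Function.extend Subtype.val f 0) (partialDeriv l f x) x
        (EuclideanSpace.single l (1 : ℝ)) := by
  obtain ⟨g, hg, hd⟩ := hf.2 l
  have hgc : Continuous fun x : X => g x := continuousOn_iff_continuous_domRestrict.mp hg
  have he : partialDeriv l f = fun x : X => g x :=
    funext (partialDeriv_eq_of_hasLineDerivAt hX hgc fun x hx => hd x hx)
  rw [he]
  exact ⟨hgc, fun x hx => hd x hx⟩

lemma KernelBounds.continuous_inner_derivSection (hK : KernelBounds H κ₁ κ₂)
    (hX : X ⊆ closure (interior X)) (hC : ∀ y : X, IsC1 (fun x : X => kerSection H y x))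
    (l : Fin p) (f : H) : Continuous fun x => inner ℝ (hK.derivSection l x) f := by
  refine continuous_inner_of_forall_kerSection (hK.norm_derivSection_le l) (fun y => ?_) f
  simp only [hK.inner_derivSection_kerSection]
  exact ((hC y).hasLineDerivAt_partialDeriv hX l).1

/-- The functions with this property form a subspace containing the kernel sections. It is closed
because convergence in `H` makes the candidate derivatives converge uniformly, their representers
being bounded by `κ₂`. -/
lemma KernelBounds.hasLineDerivAt (hK : KernelBounds H κ₁ κ₂)
    (hX : X ⊆ closure (interior X)) (hC : ∀ y : X, IsC1 (fun x : X => kerSection H y x))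
    (l : Fin p) (f : H) : ∀ x : X, (x : E p) ∈ interior X →
      HasLineDerivAt ℝ (Function.extend Subtype.val (f : X → ℝ) 0)
        (inner ℝ (hK.derivSection l x) f) x (EuclideanSpace.single l (1 : ℝ)) := by
  let M : Submodule ℝ H :=
    { carrier := {f | ∀ x : X, (x : E p) ∈ interior X →
        HasLineDerivAt ℝ (Function.extend Subtype.val (f : X → ℝ) 0)
          (inner ℝ (hK.derivSection l x) f) x (EuclideanSpace.single l (1 : ℝ))}
      add_mem' := fun {a b} ha hb x hx => by
        have := (ha x hx).add (hb x hx)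
        rw [inner_add_right, RKHS.coe_add]
        exact this.congr_of_eventuallyEq (Filter.Eventually.of_forall fun t => extend_add a b _)
      zero_mem' := fun x hx => by
        have : Function.extend Subtype.val ((0 : H) : X → ℝ) 0 = fun _ : E p => (0 : ℝ) := by
          ext z
          have := extend_smul (0 : ℝ) (0 : X → ℝ) z
          simpa using this
        rw [this, inner_zero_right]
        exact hasDerivAt_const _ _
      smul_mem' := fun c a ha x hx => by
        have := HasDerivAt.const_mul c (ha x hx)
        rw [inner_smul_right, RKHS.coe_smul]
        exact this.congr_of_eventuallyEq (Filter.Eventually.of_forall fun t => extend_smul c a _) }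
  refine mem_of_forall_kerSection_mem M ?_ (fun y x hx => ?_) f
  · refine IsSeqClosed.isClosed fun g f hg hgf x hx => ?_
    set e : E p := EuclideanSpace.single l (1 : ℝ)
    have hφ : Continuous fun t : ℝ => (x : E p) + t • e := by fun_prop
    set s : Set ℝ := (fun t : ℝ => (x : E p) + t • e) ⁻¹' interior X with hs
    have hso : IsOpen s := isOpen_interior.preimage hφ
    have h0 : (0 : ℝ) ∈ s := by simpa [hs] using hx
    have key := hasDerivAt_of_tendstoUniformlyOn (l := Filter.atTop) (s := s)
      (f := fun k t => Function.extend Subtype.val (g k : X → ℝ) 0 ((x : E p) + t • e))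
      (f' := fun k t => Function.extend Subtype.val
        (fun y : X => inner ℝ (hK.derivSection l y) (g k)) 0 ((x : E p) + t • e))
      (g := fun t => Function.extend Subtype.val (f : X → ℝ) 0 ((x : E p) + t • e))
      (g' := fun t => Function.extend Subtype.val
        (fun y : X => inner ℝ (hK.derivSection l y) f) 0 ((x : E p) + t • e))
      hso ?_ (Filter.Eventually.of_forall fun k t ht => ?_) (fun t ht => ?_) h0
    · simpa only [HasLineDerivAt, zero_smul, add_zero, Subtype.val_injective.extend_apply]
        using key
    · rw [Metric.tendstoUniformlyOn_iff]
      intro ε hε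
      have h1 := (tendsto_iff_norm_sub_tendsto_zero.mp hgf).const_mul κ₂
      rw [mul_zero] at h1
      filter_upwards [h1.eventually (gt_mem_nhds hε)] with k hk t ht
      obtain ⟨y, hy⟩ : ∃ y : X, (y : E p) = (x : E p) + t • e := ⟨⟨_, interior_subset ht⟩, rfl⟩
      rw [← hy, Subtype.val_injective.extend_apply, Subtype.val_injective.extend_apply,
        dist_comm, Real.dist_eq, ← inner_sub_right]
      exact ((abs_real_inner_le_norm _ _).trans
        (mul_le_mul_of_nonneg_right (hK.norm_derivSection_le l y) (norm_nonneg _))).trans_lt hk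
    · obtain ⟨y, hy⟩ : ∃ y : X, (y : E p) = (x : E p) + t • e := ⟨⟨_, interior_subset ht⟩, rfl⟩
      have h1 := hg k y (by rw [hy]; exact ht)
      -- The base point `0` is written `t - t` so that translation carries the derivative to `t`.
      have h2 : HasDerivAt (fun r : ℝ => Function.extend Subtype.val (g k : X → ℝ) 0
          ((y : E p) + r • e)) (inner ℝ (hK.derivSection l y) (g k)) (t - t) := by
        simpa [HasLineDerivAt] using h1
      have h3 := h2.comp_sub_const t t
      rw [← hy, Subtype.val_injective.extend_apply]
      refine h3.congr_of_eventuallyEq (Filter.Eventually.of_forall fun r => ?_)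
      simp only [hy, sub_smul]
      congr 1
      abel
    · obtain ⟨y, hy⟩ : ∃ y : X, (y : E p) = (x : E p) + t • e := ⟨⟨_, interior_subset ht⟩, rfl⟩
      simp only [← hy, Subtype.val_injective.extend_apply]
      exact ((RKHS.continuous_eval y).tendsto f).comp hgf
  · rw [hK.inner_derivSection_kerSection]
    exact ((hC y).hasLineDerivAt_partialDeriv hX l).2 x hx

lemma KernelBounds.partialDeriv_eq_inner (hK : KernelBounds H κ₁ κ₂)
    (hX : X ⊆ closure (interior X)) (hC : ∀ y : X, IsC1 (fun x : X => kerSection H y x))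
    (l : Fin p) (f : H) (x : X) :
    partialDeriv l (f : X → ℝ) x = inner ℝ (hK.derivSection l x) f :=
  partialDeriv_eq_of_hasLineDerivAt hX (hK.continuous_inner_derivSection hX hC l f)
    (hK.hasLineDerivAt hX hC l f) x

end KernelSections

/-! ### Measurable selection by Hahn–Banach and Riesz -/

section Selection

variable {Z : Type*} [MeasurableSpace Z] {P : Measure Z} [IsProbabilityMeasure P]

/-- Hahn–Banach in `L²`: a linear functional on a space of bounded functions that is dominated by
`φ ↦ ∫ max (dp φ) (dm φ)` is the integral against a measurable selection of `[dm, dp]`. -/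
lemma exists_selection_of_le_integral_max {V : Type*} [AddCommGroup V] [Module ℝ V]
    (S : V →ₗ[ℝ] Z → ℝ) (hS : ∀ h, Measurable (S h)) (hSb : ∀ h, ∃ M, ∀ z, |S h z| ≤ M)
    {dm dp : Z → ℝ} (hdm : Measurable dm) (hdp : Measurable dp) (hle : ∀ z, dm z ≤ dp z)
    {C : ℝ} (hdmC : ∀ z, |dm z| ≤ C) (hdpC : ∀ z, |dp z| ≤ C)
    (ψ : V →ₗ[ℝ] ℝ) (hψ : ∀ h, ψ h ≤ ∫ z, max (dp z * S h z) (dm z * S h z) ∂P) :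
    ∃ u : Z → ℝ, Measurable u ∧ (∀ z, dm z ≤ u z ∧ u z ≤ dp z) ∧
      ∀ h, ψ h = ∫ z, u z * S h z ∂P := by
  have hmem : ∀ h, MemLp (S h) 2 P := fun h => by
    obtain ⟨M, hM⟩ := hSb h
    exact MemLp.of_bound (hS h).aestronglyMeasurable M (.of_forall hM)
  let T : V →ₗ[ℝ] Lp ℝ 2 P :=
    { toFun := fun h => (hmem h).toLp (S h)
      map_add' := fun a b => by
        rw [← MemLp.toLp_add]
        exact MemLp.toLp_congr _ _ (by rw [map_add])
      map_smul' := fun c a => by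
        rw [RingHom.id_apply, ← MemLp.toLp_const_smul]
        exact MemLp.toLp_congr _ _ (by rw [map_smul]) }
  have hT : ∀ h, (T h : Z → ℝ) =ᵐ[P] S h := fun h => (hmem h).coeFn_toLp
  have hint : ∀ φ : Lp ℝ 2 P, Integrable φ P := fun φ => (Lp.memLp φ).integrable one_le_two
  have hd : ∀ {d : Z → ℝ}, Measurable d → (∀ z, |d z| ≤ C) → ∀ φ : Lp ℝ 2 P,
      Integrable (fun z => d z * φ z) P := fun hd hdC φ =>
    (hint φ).bdd_mul hd.aestronglyMeasurable (.of_forall hdC)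
  have hNint : ∀ φ : Lp ℝ 2 P, Integrable (fun z => max (dp z * φ z) (dm z * φ z)) P :=
    fun φ => (hd hdp hdpC φ).sup (hd hdm hdmC φ)
  let N : Lp ℝ 2 P → ℝ := fun φ => ∫ z, max (dp z * φ z) (dm z * φ z) ∂P
  have hNT : ∀ h, ψ h ≤ N (T h) := fun h => by
    refine (hψ h).trans_eq (integral_congr_ae ?_)
    filter_upwards [hT h] with z hz
    rw [hz]
  have hC : 0 ≤ C := by
    have : Nonempty Z := nonempty_of_isProbabilityMeasure P
    exact (abs_nonneg _).trans (hdmC (Classical.arbitrary Z))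
  have hN : ∀ φ, N φ ≤ C * ‖φ‖ := fun φ => by
    calc N φ ≤ ∫ z, C * ‖φ z‖ ∂P := by
          refine integral_mono (hNint φ) ((hint φ).norm.const_mul C) fun z => ?_
          refine max_le ?_ ?_
          · exact (le_abs_self _).trans (by
              rw [abs_mul]; exact mul_le_mul_of_nonneg_right (hdpC z) (abs_nonneg _))
          · exact (le_abs_self _).trans (by
              rw [abs_mul]; exact mul_le_mul_of_nonneg_right (hdmC z) (abs_nonneg _))
      _ = C * ∫ z, ‖φ z‖ ∂P := integral_const_mul _ _
      _ ≤ C * ‖φ‖ := by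
          refine mul_le_mul_of_nonneg_left ?_ hC
          rw [Lp.norm_def, integral_norm_eq_lintegral_enorm (hint φ).aestronglyMeasurable,
            ← eLpNorm_one_eq_lintegral_enorm]
          exact ENNReal.toReal_mono (Lp.eLpNorm_ne_top φ)
            (eLpNorm_le_eLpNorm_of_exponent_le one_le_two (hint φ).aestronglyMeasurable)
  -- `ψ` factors through `T`: on the kernel of `T` the domination applies to `h` and `-h`, so `ψ`
  -- vanishes there.
  obtain ⟨l, hl⟩ : ∃ l : Module.Dual ℝ (Lp ℝ 2 P), T.dualMap l = ψ := by
    have : ψ ∈ LinearMap.range T.dualMap := by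
      rw [LinearMap.range_dualMap_eq_dualAnnihilator_ker, Submodule.mem_dualAnnihilator]
      intro h hh
      have h0 : N 0 ≤ 0 := by simpa using hN 0
      have h1 := hNT h
      have h2 := hNT (-h)
      rw [map_neg, map_neg, LinearMap.mem_ker.mp hh, neg_zero] at h2
      rw [LinearMap.mem_ker.mp hh] at h1
      linarith
    exact this
  have hN_hom : ∀ c : ℝ, 0 < c → ∀ φ, N (c • φ) = c * N φ := fun c hc φ => by
    rw [← integral_const_mul]
    refine integral_congr_ae ?_
    filter_upwards [Lp.coeFn_smul c φ] with z hz
    rw [hz, Pi.smul_apply, smul_eq_mul, mul_max_of_nonneg _ _ hc.le]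
    congr 1 <;> ring
  have hN_add : ∀ φ χ, N (φ + χ) ≤ N φ + N χ := fun φ χ => by
    rw [← integral_add (hNint φ) (hNint χ)]
    refine integral_mono_ae (hNint _) ((hNint φ).add (hNint χ)) ?_
    filter_upwards [Lp.coeFn_add φ χ] with z hz
    simp only [hz, Pi.add_apply, mul_add]
    exact max_add_add_le_max_add_max
  obtain ⟨g, hgl, hgN⟩ := exists_extension_of_le_sublinear (l.toPMap (LinearMap.range T)) N
    hN_hom hN_add (by
      rintro ⟨_, h, rfl⟩
      exact (LinearMap.congr_fun hl h).trans_le (hNT h))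
  have hgT : ∀ h, g (T h) = ψ h := fun h => by
    have h1 : g (T h) = l (T h) := hgl ⟨T h, h, rfl⟩
    exact h1.trans (LinearMap.congr_fun hl h)
  -- The bound `N φ ≤ C * ‖φ‖` makes the Hahn–Banach extension continuous, so Riesz provides a
  -- density `v`.
  let G : Lp ℝ 2 P →L[ℝ] ℝ := g.mkContinuous C fun φ => by
    rw [Real.norm_eq_abs, abs_le]
    constructor
    · have := (hgN (-φ)).trans (hN (-φ))
      rw [map_neg, norm_neg] at this
      linarith
    · exact (hgN φ).trans (hN φ)
  let v : Lp ℝ 2 P := (InnerProductSpace.toDual ℝ (Lp ℝ 2 P)).symm G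
  have hv : ∀ φ : Lp ℝ 2 P, g φ = ∫ z, v z * φ z ∂P := fun φ => by
    have h1 : inner ℝ v φ = g φ := by
      rw [InnerProductSpace.toDual_symm_apply]; rfl
    rw [← h1, L2.inner_def]
    exact integral_congr_ae (.of_forall fun z => by simp [mul_comm])
  have hind : ∀ (d : Z → ℝ) (s : Set Z) (hs : MeasurableSet s) (c : ℝ),
      ∫ z, d z * indicatorConstLp 2 hs (measure_ne_top P s) c z ∂P = ∫ z in s, d z * c ∂P := by
    intro d s hs c
    rw [← integral_indicator hs]
    refine integral_congr_ae ?_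
    filter_upwards [indicatorConstLp_coeFn (p := 2) (hs := hs) (hμs := measure_ne_top P s) (c := c)]
      with z hz
    rw [hz]
    by_cases h : z ∈ s <;> simp [h]
  -- On a nonnegative function the maximum in `N` picks `dp`, on a nonpositive one `dm`; testing
  -- with indicators and their negatives traps `v`.
  have hup : (v : Z → ℝ) ≤ᵐ[P] dp := by
    refine ae_le_of_forall_setIntegral_le (hint v)
      (Integrable.of_bound hdp.aestronglyMeasurable C (.of_forall hdpC)) fun s hs _ => ?_
    have h1 := hgN (indicatorConstLp 2 hs (measure_ne_top P s) (1 : ℝ))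
    rw [hv, hind] at h1
    simp only [mul_one] at h1
    refine h1.trans_eq ?_
    rw [← integral_indicator hs]
    refine integral_congr_ae ?_
    filter_upwards [indicatorConstLp_coeFn (p := 2) (hs := hs) (hμs := measure_ne_top P s)
      (c := (1 : ℝ))] with z hz
    rw [hz]
    by_cases h : z ∈ s <;> simp [h, hle z]
  have hdown : dm ≤ᵐ[P] v := by
    refine ae_le_of_forall_setIntegral_le
      (Integrable.of_bound hdm.aestronglyMeasurable C (.of_forall hdmC)) (hint v) fun s hs _ => ?_
    have h1 := hgN (indicatorConstLp 2 hs (measure_ne_top P s) (-1 : ℝ))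
    rw [hv, hind] at h1
    simp only [mul_neg, mul_one, integral_neg] at h1
    have h2 : N (indicatorConstLp 2 hs (measure_ne_top P s) (-1 : ℝ)) = -∫ z in s, dm z ∂P := by
      rw [← integral_neg, ← integral_indicator hs]
      refine integral_congr_ae ?_
      filter_upwards [indicatorConstLp_coeFn (p := 2) (hs := hs) (hμs := measure_ne_top P s)
        (c := (-1 : ℝ))] with z hz
      rw [hz]
      by_cases h : z ∈ s <;> simp [h, hle z]
    linarith
  have hvm : AEMeasurable v P := (hint v).aestronglyMeasurable.aemeasurable
  -- Clamping a measurable version makes the bounds hold at every point, as the later pointwise use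
  -- on samples requires.
  refine ⟨fun z => max (dm z) (min (hvm.mk v z) (dp z)), hdm.max (hvm.measurable_mk.min hdp),
    fun z => ⟨le_max_left _ _, max_le (hle z) (min_le_right _ _)⟩, fun h => ?_⟩
  rw [← hgT, hv]
  refine integral_congr_ae ?_
  filter_upwards [hT h, hvm.ae_eq_mk, hup, hdown] with z h1 h2 h3 h4
  rw [h1, ← h2, min_eq_left h3, max_eq_right h4]

end Selection

/-! ### Chebyshev in Hilbert space and Hoeffding -/

section Deviation

variable {Z : Type*} [MeasurableSpace Z] {P : Measure Z} [IsProbabilityMeasure P]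

/-- Chebyshev's inequality for a sum of independent copies of a centred bounded vector of a
Hilbert space, which is only assumed to be measurable through its Gram kernel. -/
lemma measure_norm_sum_sq_ge_le {H : Type*} [NormedAddCommGroup H] [InnerProductSpace ℝ H]
    {w : Z → H} {b : ℝ} (hb : ∀ z, ‖w z‖ ≤ b)
    (hm : Measurable fun t : Z × Z => inner ℝ (w t.1) (w t.2))
    (h0 : ∀ h : H, ∫ z, inner ℝ (w z) h ∂P = 0) (n : ℕ) {s : ℝ} (hs : 0 < s) :
    Measure.pi (fun _ : Fin n => P) {z | s ≤ ‖∑ i, w (z i)‖ ^ 2} ≤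
      ENNReal.ofReal (n * b ^ 2 / s) := by
  set μ := Measure.pi (fun _ : Fin n => P) with hμ
  have hexp : ∀ z : Fin n → Z, ‖∑ i, w (z i)‖ ^ 2 = ∑ i, ∑ j, inner ℝ (w (z i)) (w (z j)) := by
    intro z
    rw [← real_inner_self_eq_norm_sq, sum_inner]
    simp_rw [inner_sum]
  have hmij : ∀ i j : Fin n, Measurable fun z : Fin n → Z => inner ℝ (w (z i)) (w (z j)) :=
    fun i j => hm.comp (f := fun z : Fin n → Z => (z i, z j)) ((measurable_pi_apply i).prodMk (measurable_pi_apply j))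
  have hb0 : ∀ z z', |inner ℝ (w z) (w z')| ≤ b ^ 2 := fun z z' => by
    refine (abs_real_inner_le_norm _ _).trans ?_
    rw [sq]
    exact mul_le_mul (hb z) (hb z') (norm_nonneg _) ((norm_nonneg _).trans (hb z))
  have hint : ∀ i j : Fin n, Integrable (fun z : Fin n → Z => inner ℝ (w (z i)) (w (z j))) μ :=
    fun i j => Integrable.of_bound (hmij i j).aestronglyMeasurable (b ^ 2)
      (.of_forall fun z => hb0 _ _)
  have hI : Integrable (fun z : Fin n → Z => ‖∑ i, w (z i)‖ ^ 2) μ := by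
    simp_rw [hexp]
    exact integrable_finsetSum _ fun i _ => integrable_finsetSum _ fun j _ => hint i j
  -- Independence and centring remove the off-diagonal Gram terms, leaving `n` terms of size at most
  -- `b ^ 2`. Fubini for the scalar Gram kernel avoids integrating `w` in `H`.
  have hoff : ∀ i j : Fin n, i ≠ j → ∫ z, inner ℝ (w (z i)) (w (z j)) ∂μ = 0 := by
    intro i j hij
    have hind : ProbabilityTheory.IndepFun (fun z : Fin n → Z => z i) (fun z => z j) μ :=
      (ProbabilityTheory.iIndepFun_pi (X := fun _ => id) fun _ => aemeasurable_id).indepFun hij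
    have hmap := (ProbabilityTheory.indepFun_iff_map_prod_eq_prod_map_map
      (measurable_pi_apply i).aemeasurable (measurable_pi_apply j).aemeasurable).mp hind
    have hpi : ∀ k : Fin n, μ.map (fun z => z k) = P := fun k =>
      (measurePreserving_eval (fun _ : Fin n => P) k).map_eq
    rw [hpi, hpi] at hmap
    have h1 : ∫ z, inner ℝ (w (z i)) (w (z j)) ∂μ =
        ∫ t, inner ℝ (w t.1) (w t.2) ∂(P.prod P) := by
      rw [← hmap, integral_map
        ((measurable_pi_apply i).prodMk (measurable_pi_apply j)).aemeasurable
        hm.aestronglyMeasurable]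
    rw [h1, integral_prod_symm _ (Integrable.of_bound hm.aestronglyMeasurable (b ^ 2)
      (.of_forall fun t => hb0 _ _))]
    simp [h0]
  have hE : ∫ z, ‖∑ i, w (z i)‖ ^ 2 ∂μ ≤ n * b ^ 2 := by
    simp_rw [hexp]
    rw [integral_finsetSum _ fun i _ => integrable_finsetSum _ fun j _ => hint i j]
    calc ∑ i : Fin n, ∫ z, ∑ j, inner ℝ (w (z i)) (w (z j)) ∂μ
        ≤ ∑ i : Fin n, b ^ 2 := by
          refine Finset.sum_le_sum fun i _ => ?_
          rw [integral_finsetSum _ fun j _ => hint i j, Finset.sum_eq_single i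
            (fun j _ hj => hoff i j hj.symm) (fun h => absurd (Finset.mem_univ i) h)]
          calc ∫ z, inner ℝ (w (z i)) (w (z i)) ∂μ ≤ ∫ z, b ^ 2 ∂μ :=
                integral_mono (hint i i) (integrable_const _)
                  fun z => (le_abs_self _).trans (hb0 _ _)
            _ = b ^ 2 := by simp
      _ = n * b ^ 2 := by simp
  have hmk := mul_meas_ge_le_integral_of_nonneg (.of_forall fun z => sq_nonneg _) hI s
  rw [← ofReal_measureReal]
  refine ENNReal.ofReal_le_ofReal ?_
  rw [le_div_iff₀ hs, mul_comm]
  exact hmk.trans hE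

open ProbabilityTheory in
/-- Hoeffding's inequality for the empirical mean of a function with values in `[0, b]`. -/
lemma measure_abs_mean_sub_integral_ge_le {φ : Z → ℝ} (hφ : Measurable φ) {b : ℝ} (hb0 : 0 < b)
    (hb : ∀ z, φ z ∈ Set.Icc 0 b) {n : ℕ} (hn : 0 < n) {t : ℝ} (ht : 0 ≤ t) :
    Measure.pi (fun _ : Fin n => P) {z | t ≤ |(1 / (n : ℝ)) * ∑ i, φ (z i) - ∫ x, φ x ∂P|} ≤
      ENNReal.ofReal (2 * Real.exp (-(2 * n * t ^ 2 / b ^ 2))) := by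
  set μ := Measure.pi (fun _ : Fin n => P) with hμ
  have hn' : (0 : ℝ) < n := by exact_mod_cast hn
  set e := ∫ x, φ x ∂P with he
  have hsub : ∀ i : Fin n, HasSubgaussianMGF (fun z : Fin n → Z => φ (z i) - e)
      ((‖b - 0‖₊ / 2) ^ 2) μ := by
    intro i
    have h1 := hasSubgaussianMGF_of_mem_Icc (μ := μ) (X := fun z : Fin n → Z => φ (z i))
      (hφ.comp (measurable_pi_apply i)).aemeasurable (.of_forall fun z => hb (z i))
    have h2 : ∫ z, φ (z i) ∂μ = e := by
      have hpi := (measurePreserving_eval (fun _ : Fin n => P) i)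
      rw [he, ← hpi.map_eq, integral_map hpi.measurable.aemeasurable hφ.aestronglyMeasurable]
    rw [h2] at h1
    exact h1
  have hindep : iIndepFun (fun (i : Fin n) (z : Fin n → Z) => φ (z i) - e) μ :=
    iIndepFun_pi (X := fun _ x => φ x - e) fun _ => (hφ.sub_const e).aemeasurable
  have hindep' : iIndepFun (fun (i : Fin n) (z : Fin n → Z) => (-fun z => φ (z i) - e) z) μ :=
    iIndepFun_pi (X := fun _ x => -(φ x - e)) fun _ => (hφ.sub_const e).neg.aemeasurable
  have hnt : 0 ≤ n * t := by positivity
  have h1 := HasSubgaussianMGF.measure_sum_ge_le_of_iIndepFun hindep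
    (s := Finset.univ) (fun i _ => hsub i) hnt
  have h2 := HasSubgaussianMGF.measure_sum_ge_le_of_iIndepFun hindep'
    (s := Finset.univ) (fun i _ => (hsub i).neg) hnt
  have hexp : -(n * t) ^ 2 / (2 * ((∑ i : Fin n, (‖b - 0‖₊ / 2) ^ 2 : NNReal) : ℝ)) =
      -(2 * n * t ^ 2 / b ^ 2) := by
    have : ((∑ i : Fin n, (‖b - 0‖₊ / 2) ^ 2 : NNReal) : ℝ) = n * (b / 2) ^ 2 := by
      simp [abs_of_pos hb0]
    rw [this]
    field_simp
  rw [hexp] at h1 h2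
  have hset : {z : Fin n → Z | t ≤ |(1 / (n : ℝ)) * ∑ i, φ (z i) - e|} ⊆
      {z | n * t ≤ ∑ i, (φ (z i) - e)} ∪
        {z | n * t ≤ ∑ i, (-fun z : Fin n → Z => φ (z i) - e) z} := by
    intro z hz
    have hs : ∑ i, (φ (z i) - e) = n * ((1 / (n : ℝ)) * ∑ i, φ (z i) - e) := by
      rw [Finset.sum_sub_distrib]
      simp
      field_simp
    have hs' : ∑ i, (-fun z : Fin n → Z => φ (z i) - e) z = -∑ i, (φ (z i) - e) := by
      simp
    rw [Set.mem_ofPred_eq] at hz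
    rcases le_abs.mp hz with h | h
    · left
      rw [Set.mem_ofPred_eq]
      rw [hs]
      exact mul_le_mul_of_nonneg_left h hn'.le
    · right
      rw [Set.mem_ofPred_eq]
      rw [hs', hs, ← mul_neg]
      exact mul_le_mul_of_nonneg_left h hn'.le
  rw [← ofReal_measureReal]
  refine ENNReal.ofReal_le_ofReal ?_
  calc μ.real _ ≤ μ.real _ := measureReal_mono hset
    _ ≤ _ := measureReal_union_le _ _
    _ ≤ _ := by rw [two_mul]; exact add_le_add h1 h2

end Deviation

/-! ### Difference quotients of convex functions -/

section Slopes

variable {g : ℝ → ℝ}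

/-- `w + r` is the convex combination of `w` and `w + e` with weight `r / e`. Negative `e` is
allowed, so both directions are covered. -/
lemma convexOn_sub_le_mul (hg : ConvexOn ℝ Set.univ g) {w e r : ℝ} (he : e ≠ 0)
    (h0 : 0 ≤ r / e) (h1 : r / e ≤ 1) : g (w + r) - g w ≤ r / e * (g (w + e) - g w) := by
  have h := hg.2 (Set.mem_univ w) (Set.mem_univ (w + e)) (sub_nonneg.mpr h1) h0 (by ring)
  simp only [smul_eq_mul] at h
  have h2 : (1 - r / e) * w + r / e * (w + e) = w + r := by field_simp; ring
  rw [h2] at h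
  linarith

lemma convexOn_sub_le_mul_max (hg : ConvexOn ℝ Set.univ g) {w ε t s : ℝ} (hε : 0 < ε)
    (ht : 0 ≤ t) (hts : t * |s| ≤ ε) :
    g (w + t * s) - g w ≤
      t * max ((g (w + ε) - g w) / ε * s) ((g w - g (w - ε)) / ε * s) := by
  rcases le_total 0 s with hs | hs
  · rw [abs_of_nonneg hs] at hts
    have h := convexOn_sub_le_mul hg (w := w) hε.ne' (r := t * s) (by positivity)
      ((div_le_one hε).mpr hts)
    refine h.trans ?_
    calc _ = t * ((g (w + ε) - g w) / ε * s) := by ring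
      _ ≤ _ := mul_le_mul_of_nonneg_left (le_max_left _ _) ht
  · rw [abs_of_nonpos hs] at hts
    have h := convexOn_sub_le_mul hg (w := w) (e := -ε) (neg_ne_zero.mpr hε.ne') (r := t * s)
      (by rw [div_neg, ← neg_div]; exact div_nonneg (by nlinarith) hε.le)
      (by rw [div_neg, ← neg_div]; exact (div_le_one hε).mpr (by linarith))
    refine h.trans ?_
    calc _ = t * ((g w - g (w - ε)) / ε * s) := by rw [← sub_eq_add_neg]; field_simp; ring
      _ ≤ _ := mul_le_mul_of_nonneg_left (le_max_right _ _) ht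

lemma convexOn_left_slope_le_right_slope (hg : ConvexOn ℝ Set.univ g) {w ε : ℝ} (hε : 0 < ε) :
    (g w - g (w - ε)) / ε ≤ (g (w + ε) - g w) / ε := by
  have h := hg.2 (Set.mem_univ (w - ε)) (Set.mem_univ (w + ε))
    (by norm_num : (0 : ℝ) ≤ 1 / 2) (by norm_num : (0 : ℝ) ≤ 1 / 2) (by norm_num)
  simp only [smul_eq_mul] at h
  have h2 : 1 / 2 * (w - ε) + 1 / 2 * (w + ε) = w := by ring
  rw [h2] at h
  exact div_le_div_of_nonneg_right (by linarith) hε.le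

/-- A number between the backward and forward difference quotients of step `ε` is a subgradient
up to an error of order `ε`. -/
lemma convexOn_mul_le_sub_add (hg : ConvexOn ℝ Set.univ g) {w ε u C : ℝ} (hε : 0 < ε)
    (hl : (g w - g (w - ε)) / ε ≤ u) (hr : u ≤ (g (w + ε) - g w) / ε)
    (hlC : |(g w - g (w - ε)) / ε| ≤ C) (hrC : |(g (w + ε) - g w) / ε| ≤ C) (s : ℝ) :
    u * s ≤ g (w + s) - g w + 2 * C * ε := by
  have hC : 0 ≤ C := (abs_nonneg _).trans hlC
  have hpos : 0 ≤ 2 * C * ε := by positivity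
  have hslope : ∀ e' s' : ℝ, 0 < e' → e' ≤ s' → ∀ σ : ℝ, σ ≠ 0 →
      s' * ((g (w + σ * e') - g w) / e') ≤ g (w + σ * s') - g w := by
    intro e' s' he' hes σ hσ
    have hs' := he'.trans_le hes
    have h := convexOn_sub_le_mul hg (w := w) (e := σ * s') (r := σ * e')
      (mul_ne_zero hσ hs'.ne') (by rw [mul_div_mul_left _ _ hσ]; positivity)
      (by rw [mul_div_mul_left _ _ hσ]; exact (div_le_one hs').mpr hes)
    rw [mul_div_mul_left _ _ hσ] at h
    calc _ = s' / e' * (g (w + σ * e') - g w) := by ring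
      _ ≤ s' / e' * (e' / s' * (g (w + σ * s') - g w)) :=
          mul_le_mul_of_nonneg_left h (by positivity)
      _ = _ := by field_simp
  rw [abs_le] at hlC hrC
  -- For `|s| ≥ ε`, monotone difference quotients give the bound without error. For `|s| < ε`, `u *
  -- s` exceeds the slope bound obtained from the opposite side by at most `2 * C * |s|`.
  rcases le_or_gt ε s with h | h
  · have h1 := hslope ε s hε h 1 one_ne_zero
    rw [one_mul, one_mul] at h1
    nlinarith [mul_le_mul_of_nonneg_right hr (hε.le.trans h)]
  rcases le_or_gt ε (-s) with h' | h'
  · have h1 := hslope ε (-s) hε h' (-1) (by norm_num)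
    have h2 : w + -1 * -s = w + s := by ring
    have h3 : w + -1 * ε = w - ε := by ring
    rw [h2, h3] at h1
    have h4 : (g (w - ε) - g w) / ε = -((g w - g (w - ε)) / ε) := by ring
    rw [h4] at h1
    nlinarith [mul_le_mul_of_nonneg_right hl (hε.le.trans h')]
  · have hmid : ∀ σ : ℝ, g w - g (w + -1 * σ) ≤ g (w + σ) - g w := fun σ => by
      have h := hg.2 (Set.mem_univ (w + -1 * σ)) (Set.mem_univ (w + σ))
        (by norm_num : (0 : ℝ) ≤ 1 / 2) (by norm_num : (0 : ℝ) ≤ 1 / 2) (by norm_num)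
      simp only [smul_eq_mul] at h
      have h2 : 1 / 2 * (w + -1 * σ) + 1 / 2 * (w + σ) = w := by ring
      rw [h2] at h
      linarith
    rcases lt_trichotomy s 0 with hs | hs | hs
    · have h1 := convexOn_sub_le_mul hg (w := w) hε.ne' (r := -s)
        (div_nonneg (by linarith) hε.le) ((div_le_one hε).mpr h'.le)
      have h2 := hmid (-s)
      rw [show w + -1 * -s = w + s by ring] at h2
      have h3 : -s / ε * (g (w + ε) - g w) = -s * ((g (w + ε) - g w) / ε) := by ring
      rw [h3] at h1
      nlinarith
    · subst hs; simpa using hpos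
    · have h1 := convexOn_sub_le_mul hg (w := w) (e := -ε) (neg_ne_zero.mpr hε.ne') (r := -1 * s)
        (by rw [neg_one_mul, neg_div_neg_eq]; positivity)
        (by rw [neg_one_mul, neg_div_neg_eq]; exact (div_le_one hε).mpr h.le)
      have h2 := hmid s
      have h3 : -1 * s / -ε * (g (w + -ε) - g w) = -(s * ((g w - g (w - ε)) / ε)) := by
        rw [← sub_eq_add_neg]; field_simp; ring
      rw [h3] at h1
      nlinarith

end Slopes

/-! ### First order condition and concentration of the M-estimator -/

section Representer

variable {p : ℕ} {X : Set (E p)} {Y : Set ℝ}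
variable {H : Type*} [NormedAddCommGroup H] [InnerProductSpace ℝ H] [CompleteSpace H]
variable [RKHS ℝ H X ℝ]
variable {q c₁ : ℝ} {c₂ : ℝ → ℝ} {L : Y → ℝ → ℝ} {κ₁ κ₂ : ℝ}
variable {P : Measure (X × Y)} [IsProbabilityMeasure P]

/-- A finite convex function on `ℝ` is continuous, so `L` is a Carathéodory function and jointly
measurable. -/
lemma LossConditions.measurable_comp (hL : LossConditions q c₁ c₂ L) {Z : Type*}
    [MeasurableSpace Z] {y : Z → Y} (hy : Measurable y) {f : Z → ℝ} (hf : Measurable f) :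
    Measurable fun z => L (y z) (f z) := by
  have h : Measurable (Function.uncurry fun (w : ℝ) (y : Y) => L y w) :=
    measurable_uncurry_of_continuous_of_measurable
      (fun y => continuousOn_univ.mp ((hL.convex y).continuousOn isOpen_univ)) hL.measurable
  exact h.comp (hf.prodMk hy)

/-- By symmetry the kernel is continuous in each variable separately, which suffices for joint
measurability. -/
lemma KernelBounds.measurable_kerSection (hK : KernelBounds H κ₁ κ₂)
    (hC : ∀ y : X, IsC1 (fun x : X => kerSection H y x)) :
    Measurable fun t : X × X => kerSection H t.1 t.2 := by
  have hsymm : ∀ x y : X, kerSection H x y = kerSection H y x := fun x y => by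
    rw [← inner_kerSection, ← inner_kerSection, real_inner_comm]
  refine measurable_uncurry_of_continuous_of_measurable
    (u := fun x y : X => kerSection H x y) (fun y => ?_) fun x => ?_
  · simp_rw [fun x => hsymm x y]
    exact hK.continuous_coe hC _
  · exact (hK.continuous_coe hC _).measurable

/-- The first order condition for the regularized risk minimizer `f₀`: up to an error of order `ε`
it is represented by a measurable subgradient `u` of the loss, `-2 lam f₀ = E u(x, y) K_x`. -/
lemma exists_approx_subgradient (hL : LossConditions q c₁ c₂ L) (hK : KernelBounds H κ₁ κ₂)
    (hC : ∀ y : X, IsC1 (fun x : X => kerSection H y x)) {lam : ℝ} (hlam : 0 < lam) {f₀ : H}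
    (hfin : risk P L f₀ ≠ ⊤) (hmin : IsRegRiskMinimizer P L lam f₀)
    {R : ℝ} (hR : κ₁ * ‖f₀‖ + 1 ≤ R) {ε : ℝ} (hε : 0 < ε) (hε1 : ε ≤ 1) :
    ∃ u : X × Y → ℝ, Measurable u ∧ (∀ z, |u z| ≤ c₂ R) ∧
      (∀ z s, u z * s ≤ L z.2 (f₀ z.1 + s) - L z.2 (f₀ z.1) + 2 * c₂ R * ε) ∧
      ∀ h : H, -(2 * lam) * inner ℝ f₀ h = ∫ z, u z * h z.1 ∂P := by
  have hcm : ∀ h : H, Measurable fun z : X × Y => h z.1 := fun h =>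
    (hK.continuous_coe hC h).measurable.comp measurable_fst
  -- The margin `1 ≥ ε` keeps `f₀ ± ε` inside `[-R, R]`, where the Lipschitz constant is `c₂ R`.
  have hf0 : ∀ z : X × Y, |f₀ z.1| ≤ R - 1 := fun z =>
    (hK.abs_apply_le f₀ z.1).trans (by linarith)
  have hR0 : 0 ≤ R := by
    have : Nonempty (X × Y) := nonempty_of_isProbabilityMeasure P
    linarith [(abs_nonneg _).trans (hf0 (Classical.arbitrary _))]
  have hLip : ∀ (z : X × Y) (w w' : ℝ), |w| ≤ R → |w'| ≤ R → |w - w'| = ε →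
      |(L z.2 w - L z.2 w') / ε| ≤ c₂ R := by
    intro z w w' hw hw' hww
    rw [abs_div, abs_of_pos hε, div_le_iff₀ hε, ← hww]
    exact hL.lipschitz R hR0 z.2 w (abs_le.mp hw) w' (abs_le.mp hw')
  set dp : X × Y → ℝ := fun z => (L z.2 (f₀ z.1 + ε) - L z.2 (f₀ z.1)) / ε with hdp
  set dm : X × Y → ℝ := fun z => (L z.2 (f₀ z.1) - L z.2 (f₀ z.1 - ε)) / ε with hdm
  have hdpm : Measurable dp :=
    ((hL.measurable_comp measurable_snd ((hcm f₀).add_const ε)).sub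
      (hL.measurable_comp measurable_snd (hcm f₀))).div_const ε
  have hdmm : Measurable dm :=
    ((hL.measurable_comp measurable_snd (hcm f₀)).sub
      (hL.measurable_comp measurable_snd ((hcm f₀).sub_const ε))).div_const ε
  have hdpC : ∀ z, |dp z| ≤ c₂ R := fun z => by
    have h := abs_le.mp (hf0 z)
    refine hLip z _ _ (abs_le.mpr ⟨by linarith, by linarith⟩)
      (abs_le.mpr ⟨by linarith, by linarith⟩) ?_
    rw [add_sub_cancel_left, abs_of_pos hε]
  have hdmC : ∀ z, |dm z| ≤ c₂ R := fun z => by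
    have h := abs_le.mp (hf0 z)
    refine hLip z _ _ (abs_le.mpr ⟨by linarith, by linarith⟩)
      (abs_le.mpr ⟨by linarith, by linarith⟩) ?_
    rw [sub_sub_cancel, abs_of_pos hε]
  have hdd : ∀ z, dm z ≤ dp z := fun z =>
    convexOn_left_slope_le_right_slope (hL.convex z.2) hε
  let S : H →ₗ[ℝ] X × Y → ℝ :=
    { toFun := fun h z => h z.1
      map_add' := fun a b => by ext z; simp
      map_smul' := fun c a => by ext z; simp }
  have hSb : ∀ h, ∀ z, |S h z| ≤ κ₁ * ‖h‖ := fun h z => hK.abs_apply_le h z.1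
  have hSm : ∀ h, Measurable (S h) := hcm
  let ψ : H →ₗ[ℝ] ℝ := (-(2 * lam)) • (innerₛₗ ℝ f₀)
  have hψ : ∀ h, ψ h = -(2 * lam) * inner ℝ f₀ h := fun h => by simp [ψ]
  have hLint : Integrable (fun z : X × Y => L z.2 (f₀ z.1)) P := by
    refine (lintegral_ofReal_ne_top_iff_integrable
      (hL.measurable_comp measurable_snd (hcm f₀)).aestronglyMeasurable
      (.of_forall fun z => hL.nonneg _ _)).mp hfin
  obtain ⟨u, hu, huI, hur⟩ := exists_selection_of_le_integral_max (P := P) S hSm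
    (fun h => ⟨_, hSb h⟩) hdmm hdpm hdd hdmC hdpC ψ (by
    intro h
    rw [hψ]
    set m : X × Y → ℝ := fun z => max (dp z * S h z) (dm z * S h z) with hmdef
    have hSi : Integrable (S h) P :=
      Integrable.of_bound (hSm h).aestronglyMeasurable (κ₁ * ‖h‖) (.of_forall (hSb h))
    have hmi : Integrable m P :=
      (hSi.bdd_mul hdpm.aestronglyMeasurable (.of_forall hdpC)).sup
        (hSi.bdd_mul hdmm.aestronglyMeasurable (.of_forall hdmC))
    -- Minimality of `f₀` against `f₀ + t • h`, divided by `t`; the limit `t → 0` then yields the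
    -- domination of `ψ`.
    have hstep : ∀ t : ℝ, 0 < t → t * (κ₁ * ‖h‖) ≤ ε →
        -(2 * lam) * inner ℝ f₀ h ≤ ∫ z, m z ∂P + t * (lam * ‖h‖ ^ 2) := by
      intro t ht hte
      have hpt : ∀ z, L z.2 ((f₀ + t • h) z.1) ≤ L z.2 (f₀ z.1) + t * m z := fun z => by
        have h1 := convexOn_sub_le_mul_max (hL.convex z.2) (w := f₀ z.1) (s := h z.1) hε ht.le
          ((mul_le_mul_of_nonneg_left (hSb h z) ht.le).trans hte)
        have h2 : (f₀ + t • h) z.1 = f₀ z.1 + t * h z.1 := by simp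
        rw [h2]
        exact sub_le_iff_le_add'.mp h1
      have hr0 : risk P L f₀ = ENNReal.ofReal (∫ z, L z.2 (f₀ z.1) ∂P) :=
        (ofReal_integral_eq_lintegral_ofReal hLint (.of_forall fun z => hL.nonneg _ _)).symm
      have hI : Integrable (fun z => L z.2 (f₀ z.1) + t * m z) P := hLint.add (hmi.const_mul t)
      have hnn : ∀ z, 0 ≤ L z.2 (f₀ z.1) + t * m z := fun z => (hL.nonneg _ _).trans (hpt z)
      have hrt : risk P L (f₀ + t • h) ≤
          ENNReal.ofReal (∫ z, (L z.2 (f₀ z.1) + t * m z) ∂P) := by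
        rw [ofReal_integral_eq_lintegral_ofReal hI (.of_forall hnn)]
        exact lintegral_mono fun z => ENNReal.ofReal_le_ofReal (hpt z)
      have hm := (hmin (f₀ + t • h)).trans (add_le_add_left hrt _)
      rw [hr0, ← ENNReal.ofReal_add (integral_nonneg fun z => hL.nonneg _ _) (by positivity),
        ← ENNReal.ofReal_add (integral_nonneg hnn) (by positivity),
        ENNReal.ofReal_le_ofReal_iff (add_nonneg (integral_nonneg hnn) (by positivity)),
        integral_add hLint (hmi.const_mul t), integral_const_mul, norm_add_sq_real,
        inner_smul_right, norm_smul, mul_pow, Real.norm_eq_abs, sq_abs] at hm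
      have h3 : 0 ≤ t * (∫ z, m z ∂P + t * (lam * ‖h‖ ^ 2) + 2 * lam * inner ℝ f₀ h) := by
        linarith
      have := nonneg_of_mul_nonneg_right h3 ht
      linarith
    refine ge_of_tendsto (x := 𝓝[>] (0 : ℝ)) (b := -(2 * lam) * inner ℝ f₀ h)
      (f := fun t => ∫ z, m z ∂P + t * (lam * ‖h‖ ^ 2)) ?_ ?_
    · have : Filter.Tendsto (fun t : ℝ => ∫ z, m z ∂P + t * (lam * ‖h‖ ^ 2)) (𝓝 0)
          (𝓝 (∫ z, m z ∂P + 0 * (lam * ‖h‖ ^ 2))) := by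
        apply Continuous.tendsto; fun_prop
      rw [zero_mul, add_zero] at this
      exact this.mono_left nhdsWithin_le_nhds
    · have h1 : Filter.Tendsto (fun t : ℝ => t * (κ₁ * ‖h‖)) (𝓝 0) (𝓝 (0 * (κ₁ * ‖h‖))) := by
        apply Continuous.tendsto; fun_prop
      rw [zero_mul] at h1
      filter_upwards [self_mem_nhdsWithin,
        nhdsWithin_le_nhds (h1.eventually (gt_mem_nhds hε))] with t ht hte
      exact hstep t ht hte.le)
  refine ⟨u, hu, fun z => ?_, fun z s => ?_, fun h => ?_⟩
  · have h1 := abs_le.mp (hdmC z)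
    have h2 := abs_le.mp (hdpC z)
    exact abs_le.mpr ⟨h1.1.trans (huI z).1, (huI z).2.trans h2.2⟩
  · exact convexOn_mul_le_sub_add (hL.convex z.2) hε (huI z).1 (huI z).2 (hdmC z) (hdpC z) s
  · rw [← hψ, hur]
    rfl

/-- Expanding `‖f‖ ^ 2` about `f₀` leaves a surplus `‖d‖ ^ 2`, `d = f - f₀`. Optimality against `f₀`
and the approximate subgradient inequality give `n * lam * ‖d‖ ^ 2 ≤ ‖W‖ * ‖d‖ + n * η`, and half of
`‖d‖ ^ 2` absorbs the product. -/
lemma norm_sub_sq_le_of_isMEstimator {lam : ℝ} (hlam : 0 < lam) {f₀ f : H} {n : ℕ} (hn : 0 < n)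
    {z : Fin n → X × Y} (hf : IsMEstimator L lam z f) {u : X × Y → ℝ} {η : ℝ}
    (hu : ∀ z s, u z * s ≤ L z.2 (f₀ z.1 + s) - L z.2 (f₀ z.1) + η) :
    ‖f - f₀‖ ^ 2 ≤
      ‖∑ i, (u (z i) • kerSection H (z i).1 + (2 * lam) • f₀)‖ ^ 2 / (n * lam) ^ 2 +
        2 * η / lam := by
  have hn' : (0 : ℝ) < n := by exact_mod_cast hn
  set W := ∑ i, (u (z i) • kerSection H (z i).1 + (2 * lam) • f₀) with hW
  set d := f - f₀ with hd
  have hfd : f = f₀ + d := by rw [hd]; abel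
  have h1 : inner ℝ W d = ∑ i, u (z i) * d (z i).1 + n * (2 * lam * inner ℝ f₀ d) := by
    rw [hW, sum_inner]
    simp only [inner_add_left, real_inner_smul_left, inner_kerSection]
    rw [Finset.sum_add_distrib]
    simp
  have h2 : ∑ i, u (z i) * d (z i).1 ≤
      ∑ i, L (z i).2 (f (z i).1) - ∑ i, L (z i).2 (f₀ (z i).1) + n * η := by
    calc _ ≤ ∑ i, (L (z i).2 (f (z i).1) - L (z i).2 (f₀ (z i).1) + η) := by
          refine Finset.sum_le_sum fun i _ => (hu (z i) (d (z i).1)).trans_eq ?_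
          rw [hfd]; simp
      _ = _ := by rw [Finset.sum_add_distrib, Finset.sum_sub_distrib]; simp
  have h3 := hf f₀
  have h4 : ‖f‖ ^ 2 = ‖f₀‖ ^ 2 + 2 * inner ℝ f₀ d + ‖d‖ ^ 2 := by
    rw [hfd, norm_add_sq_real]
  have h5 : ∑ i, L (z i).2 (f (z i).1) - ∑ i, L (z i).2 (f₀ (z i).1) ≤
      n * (lam * ‖f₀‖ ^ 2 - lam * ‖f‖ ^ 2) := by
    have := mul_le_mul_of_nonneg_left h3 hn'.le
    have hone : ∀ a : ℝ, n * (1 / n * a) = a := fun a => by field_simp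
    rw [mul_add, mul_add, hone, hone] at this
    linarith
  have h6 : -(‖W‖ * ‖d‖) ≤ inner ℝ W d := (abs_le.mp (abs_real_inner_le_norm W d)).1
  have h7 : n * lam * ‖d‖ ^ 2 ≤ ‖W‖ * ‖d‖ + n * η := by
    rw [h4] at h5
    nlinarith
  have h8 : ‖d‖ ^ 2 ≤ ‖W‖ / (n * lam) * ‖d‖ + η / lam := by
    have h9 : ‖W‖ / (n * lam) * ‖d‖ + η / lam = (‖W‖ * ‖d‖ + n * η) / (n * lam) := by
      field_simp
    rw [h9, le_div_iff₀ (by positivity)]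
    linarith
  rw [← div_pow, mul_div_assoc]
  nlinarith [sq_nonneg (‖W‖ / (n * lam) - ‖d‖)]

/-- The regularized M-estimator concentrates around the regularized risk minimizer. -/
theorem measure_norm_sub_sq_ge_le (hL : LossConditions q c₁ c₂ L) (hK : KernelBounds H κ₁ κ₂)
    (hC : ∀ y : X, IsC1 (fun x : X => kerSection H y x)) {lam : ℝ} (hlam : 0 < lam) {f₀ : H}
    (hfin : risk P L f₀ ≠ ⊤) (hmin : IsRegRiskMinimizer P L lam f₀)
    {R : ℝ} (hR : κ₁ * ‖f₀‖ + 1 ≤ R) (hc₂ : 0 < c₂ R) {n : ℕ} (hn : 0 < n)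
    {fhat : (Fin n → X × Y) → H} (hf : ∀ z, IsMEstimator L lam z (fhat z))
    {ρ : ℝ} (hρ : 0 < ρ) :
    Measure.pi (fun _ : Fin n => P) {z | ρ ≤ ‖fhat z - f₀‖ ^ 2} ≤
      ENNReal.ofReal (8 * (c₂ R * κ₁) ^ 2 / (n * lam ^ 2 * ρ)) := by
  have hn' : (0 : ℝ) < n := by exact_mod_cast hn
  -- The subgradient error may consume half of `ρ`; Chebyshev handles the other half.
  obtain ⟨ε, hε, hε1, hερ⟩ : ∃ ε : ℝ, 0 < ε ∧ ε ≤ 1 ∧ 2 * (2 * c₂ R * ε) / lam ≤ ρ / 2 := by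
    refine ⟨min 1 (ρ * lam / (8 * c₂ R)), lt_min one_pos (by positivity), min_le_left _ _, ?_⟩
    calc _ ≤ 2 * (2 * c₂ R * (ρ * lam / (8 * c₂ R))) / lam := by gcongr; exact min_le_right _ _
      _ = ρ / 2 := by field_simp; norm_num
  obtain ⟨u, hum, huC, hus, hur⟩ :=
    exists_approx_subgradient hL hK hC hlam hfin hmin hR hε hε1
  have hcm : ∀ h : H, Measurable fun z : X × Y => h z.1 := fun h =>
    (hK.continuous_coe hC h).measurable.comp measurable_fst
  have huh : ∀ h : H, ∀ z : X × Y, |u z * h z.1| ≤ c₂ R * (κ₁ * ‖h‖) := fun h z => by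
    rw [abs_mul]
    exact mul_le_mul (huC z) (hK.abs_apply_le h z.1) (abs_nonneg _) hc₂.le
  have huint : ∀ h : H, Integrable (fun z : X × Y => u z * h z.1) P := fun h =>
    Integrable.of_bound (hum.mul (hcm h)).aestronglyMeasurable _ (.of_forall (huh h))
  -- The first order condition, tested on `(2 * lam) • f₀` itself, bounds the mean by the bound on
  -- `u K_x`.
  have hg : ‖(2 * lam) • f₀‖ ≤ c₂ R * κ₁ := by
    rcases eq_or_ne ((2 * lam) • f₀) 0 with h0 | h0
    · rw [h0, norm_zero]
      have hZ : Nonempty (X × Y) := nonempty_of_isProbabilityMeasure P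
      exact mul_nonneg hc₂.le ((norm_nonneg _).trans (hK.kernel (Classical.arbitrary _ : X × Y).1))
    · have h1 : ‖(2 * lam) • f₀‖ ^ 2 ≤ c₂ R * (κ₁ * ‖(2 * lam) • f₀‖) := by
        rw [← real_inner_self_eq_norm_sq]
        nth_rewrite 1 [real_inner_smul_left]
        rw [← neg_neg (2 * lam * _), ← neg_mul, hur, ← integral_neg]
        calc _ ≤ ∫ z : X × Y, c₂ R * (κ₁ * ‖(2 * lam) • f₀‖) ∂P :=
              integral_mono (huint _).neg (integrable_const _)
                fun z => (neg_le_abs _).trans (huh _ z)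
          _ = _ := by simp
      have h2 := norm_pos_iff.mpr h0
      nlinarith
  set w : X × Y → H := fun z => u z • kerSection H z.1 + (2 * lam) • f₀ with hw
  have hwb : ∀ z, ‖w z‖ ≤ 2 * (c₂ R * κ₁) := fun z => by
    refine (norm_add_le _ _).trans ?_
    rw [two_mul (c₂ R * κ₁)]
    refine add_le_add ?_ hg
    rw [norm_smul]
    exact mul_le_mul (huC z) (hK.kernel z.1) (norm_nonneg _) hc₂.le
  have hwi : ∀ z (h : H), inner ℝ (w z) h = u z * h z.1 + 2 * lam * inner ℝ f₀ h := fun z h => by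
    rw [hw]
    simp only [inner_add_left, real_inner_smul_left, inner_kerSection]
  have hw0 : ∀ h : H, ∫ z, inner ℝ (w z) h ∂P = 0 := fun h => by
    simp_rw [hwi]
    rw [integral_add (huint h) (integrable_const _), ← hur]
    simp
  have hwm : Measurable fun t : (X × Y) × (X × Y) => inner ℝ (w t.1) (w t.2) := by
    have h1 : ∀ t : (X × Y) × (X × Y), inner ℝ (w t.1) (w t.2) =
        u t.1 * (u t.2 * kerSection H t.2.1 t.1.1 + 2 * lam * f₀ t.1.1) +
          2 * lam * (u t.2 * f₀ t.2.1 + 2 * lam * ‖f₀‖ ^ 2) := fun t => by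
      rw [hwi]
      have h2 : inner ℝ f₀ (w t.2) = u t.2 * f₀ t.2.1 + 2 * lam * ‖f₀‖ ^ 2 := by
        rw [real_inner_comm, hwi, real_inner_self_eq_norm_sq]
      rw [h2, hw]
      simp
    simp_rw [h1]
    have hk : Measurable fun t : (X × Y) × (X × Y) => kerSection H t.2.1 t.1.1 :=
      (hK.measurable_kerSection hC).comp (f := fun t : (X × Y) × (X × Y) => (t.2.1, t.1.1))
        (by fun_prop)
    have hu1 : Measurable fun t : (X × Y) × (X × Y) => u t.1 := hum.comp measurable_fst
    have hu2 : Measurable fun t : (X × Y) × (X × Y) => u t.2 := hum.comp measurable_snd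
    have hf1 : Measurable fun t : (X × Y) × (X × Y) => f₀ t.1.1 := (hcm f₀).comp measurable_fst
    have hf2 : Measurable fun t : (X × Y) × (X × Y) => f₀ t.2.1 := (hcm f₀).comp measurable_snd
    exact (hu1.mul ((hu2.mul hk).add (hf1.const_mul _))).add
      (((hu2.mul hf2).add_const _).const_mul _)
  have hs : 0 < (n * lam) ^ 2 * (ρ / 2) := by positivity
  refine (measure_mono fun z hz => ?_).trans
    ((measure_norm_sum_sq_ge_le hwb hwm hw0 n hs).trans_eq ?_)
  · rw [Set.mem_ofPred_eq] at hz ⊢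
    have h1 := hz.trans (norm_sub_sq_le_of_isMEstimator hlam hn (hf z) hus)
    have h2 : ρ / 2 ≤ ‖∑ i, w (z i)‖ ^ 2 / (n * lam) ^ 2 := by
      simp only [hw]
      linarith
    rwa [le_div_iff₀ (by positivity), mul_comm] at h2
  · congr 1
    field_simp
    ring

end Representer

/-! ### Stability and concentration of gradient norms -/

section GradientNormEstimates

variable {p : ℕ} {X : Set (E p)} {Y : Set ℝ}
variable {H : Type*} [NormedAddCommGroup H] [InnerProductSpace ℝ H] [CompleteSpace H]
variable [RKHS ℝ H X ℝ]
variable {q c₁ : ℝ} {c₂ : ℝ → ℝ} {L : Y → ℝ → ℝ} {κ₁ κ₂ : ℝ}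
variable {P : Measure (X × Y)} [IsProbabilityMeasure P]

omit [CompleteSpace H] [IsProbabilityMeasure P] in
/-- The response cannot vanish almost surely unless the target and the regularized risk minimizer
both vanish. -/
lemma integral_abs_response_pos (hL : LossConditions q c₁ c₂ L) (hq : 1 ≤ q)
    (hint : Integrable (fun z : X × Y => |(z.2 : ℝ)|) P) {lam : ℝ} (hlam : 0 < lam)
    {fstar ftilde : H} (hstar : IsTarget P L fstar) (htilde : IsRegRiskMinimizer P L lam ftilde)
    (hne : 0 < ‖ftilde - fstar‖) : 0 < ∫ z : X × Y, |(z.2 : ℝ)| ∂P := by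
  refine lt_of_le_of_ne (integral_nonneg fun z => abs_nonneg _) fun h0 => ?_
  have hae := (integral_eq_zero_iff_of_nonneg (fun z => abs_nonneg _) hint).mp h0.symm
  -- If the response vanishes almost surely, the growth bound makes the zero function optimal in
  -- both problems, so both minimizers are zero.
  have hrisk : risk P L (0 : H) = 0 := by
    rw [risk, lintegral_congr_ae (g := fun _ => 0) ?_, lintegral_zero]
    filter_upwards [hae] with z hz
    have h1 := hL.growth z.2 ((0 : H) z.1)
    rw [show |(z.2 : ℝ)| = 0 from hz] at h1
    simp only [RKHS.coe_zero, Pi.zero_apply, abs_zero,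
      Real.zero_rpow (by linarith : q ≠ 0), add_zero, mul_zero] at h1 ⊢
    exact ENNReal.ofReal_eq_zero.mpr h1
  have hs : ‖fstar‖ ≤ 0 := by
    have := hstar.2 0 ⟨by simp [hrisk], fun h => by simp [hrisk]⟩
    simpa using this
  have ht : ENNReal.ofReal (lam * ‖ftilde‖ ^ 2) ≤ 0 := by
    have := htilde 0
    rw [hrisk] at this
    simp only [norm_zero] at this
    refine (self_le_add_left _ _).trans (this.trans_eq ?_)
    simp
  have ht' := ENNReal.ofReal_eq_zero.mp (le_antisymm ht bot_le)
  have ht0 : ‖ftilde‖ = 0 := by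
    by_contra h
    have : 0 < ‖ftilde‖ := lt_of_le_of_ne (norm_nonneg _) (Ne.symm h)
    have : 0 < lam * ‖ftilde‖ ^ 2 := by positivity
    linarith
  have := norm_sub_le ftilde fstar
  linarith

lemma KernelBounds.abs_empNormSq_sub_le (hK : KernelBounds H κ₁ κ₂)
    (hX : X ⊆ closure (interior X)) (hC : ∀ y : X, IsC1 (fun x : X => kerSection H y x))
    (l : Fin p) (f g : H) {n : ℕ} (hn : 0 < n) (z : Fin n → X × Y) :
    |empNormSq z (partialDeriv l (f : X → ℝ)) - empNormSq z (partialDeriv l (g : X → ℝ))| ≤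
      κ₂ ^ 2 * (‖f - g‖ * (‖f‖ + ‖g‖)) := by
  have hn' : (0 : ℝ) < n := by exact_mod_cast hn
  rw [empNormSq, empNormSq, ← mul_sub, ← Finset.sum_sub_distrib, abs_mul,
    abs_of_pos (by positivity : 0 < 1 / (n : ℝ)), one_div, inv_mul_le_iff₀ hn']
  refine (Finset.abs_sum_le_sum_abs _ _).trans ?_
  have hterm : ∀ i, |partialDeriv l (f : X → ℝ) (z i).1 ^ 2 -
      partialDeriv l (g : X → ℝ) (z i).1 ^ 2| ≤ κ₂ ^ 2 * (‖f - g‖ * (‖f‖ + ‖g‖)) := fun i => by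
    rw [hK.partialDeriv_eq_inner hX hC, hK.partialDeriv_eq_inner hX hC, sq_sub_sq,
      ← inner_add_right, ← inner_sub_right, abs_mul]
    set D := hK.derivSection l (z i).1
    have hD : ‖D‖ ≤ κ₂ := hK.norm_derivSection_le l _
    have hκ : 0 ≤ κ₂ := (norm_nonneg _).trans hD
    calc _ ≤ (κ₂ * (‖f‖ + ‖g‖)) * (κ₂ * ‖f - g‖) := by
          refine mul_le_mul ?_ ?_ (abs_nonneg _) (by positivity)
          · exact (abs_real_inner_le_norm _ _).trans
              (mul_le_mul hD (norm_add_le _ _) (norm_nonneg _) hκ)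
          · exact (abs_real_inner_le_norm _ _).trans
              (mul_le_mul_of_nonneg_right hD (norm_nonneg _))
      _ = _ := by ring
  refine (Finset.sum_le_sum fun i _ => hterm i).trans_eq ?_
  simp

/-- Uniform concentration of the empirical norms of the partial derivatives of a fixed function. -/
lemma KernelBounds.measure_abs_empNormSq_sub_popNormSq_ge_le (hK : KernelBounds H κ₁ κ₂)
    (hX : X ⊆ closure (interior X)) (hC : ∀ y : X, IsC1 (fun x : X => kerSection H y x))
    (f : H) {b : ℝ} (hb : 0 < b) (hfb : κ₂ * ‖f‖ ≤ b) {n : ℕ} (hn : 0 < n) {t : ℝ} (ht : 0 ≤ t) :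
    Measure.pi (fun _ : Fin n => P) {z | ∃ l : Fin p,
        t ≤ |empNormSq z (partialDeriv l (f : X → ℝ)) - popNormSq P (partialDeriv l (f : X → ℝ))|} ≤
      ENNReal.ofReal (p * (2 * Real.exp (-(2 * n * t ^ 2 / (b ^ 2) ^ 2)))) := by
  have hcont : ∀ l : Fin p, Continuous (partialDeriv l (f : X → ℝ)) := fun l => by
    rw [funext (hK.partialDeriv_eq_inner hX hC l f)]
    exact hK.continuous_inner_derivSection hX hC l f
  have hle : ∀ l : Fin p, Measure.pi (fun _ : Fin n => P) {z | t ≤ |empNormSq z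
      (partialDeriv l (f : X → ℝ)) - popNormSq P (partialDeriv l (f : X → ℝ))|} ≤
        ENNReal.ofReal (2 * Real.exp (-(2 * n * t ^ 2 / (b ^ 2) ^ 2))) := fun l => by
    have hm : Measurable fun x : X => partialDeriv l (f : X → ℝ) x ^ 2 :=
      ((hcont l).pow 2).measurable
    have hpop : popNormSq P (partialDeriv l (f : X → ℝ)) =
        ∫ z : X × Y, partialDeriv l (f : X → ℝ) z.1 ^ 2 ∂P := by
      rw [popNormSq, Measure.fst, integral_map measurable_fst.aemeasurable
        hm.aestronglyMeasurable]
    rw [hpop]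
    refine measure_abs_mean_sub_integral_ge_le
      (φ := fun z : X × Y => partialDeriv l (f : X → ℝ) z.1 ^ 2) (hm.comp measurable_fst)
      (by positivity) (fun z => ⟨sq_nonneg _, ?_⟩) hn ht
    rw [← sq_abs, hK.partialDeriv_eq_inner hX hC]
    refine pow_le_pow_left₀ (abs_nonneg _) ?_ 2
    exact ((abs_real_inner_le_norm _ _).trans
      (mul_le_mul_of_nonneg_right (hK.norm_derivSection_le l _) (norm_nonneg _))).trans hfb
  rw [Set.ofPred_exists]
  refine (measure_iUnion_fintype_le _ _).trans ((Finset.sum_le_sum fun l _ => hle l).trans_eq ?_)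
  rw [ENNReal.ofReal_mul (by positivity : (0 : ℝ) ≤ p)]
  simp

end GradientNormEstimates

/-! ### Numerical rates -/

section Rates

/-- The exponent `1/8` is what can be lost: `1/2 - 1/8 = 3/8` is twice the target exponent `3/16`.
-/
lemma log_rpow_inv_le {n q : ℝ} (hn : 1 ≤ n) (hq : 1 ≤ q) :
    Real.log n ^ (1 / q) ≤ 8 * n ^ (1 / 8 : ℝ) := by
  have hlog : 0 ≤ Real.log n := Real.log_nonneg hn
  have h1 : 1 ≤ n ^ (1 / 8 : ℝ) := Real.one_le_rpow hn (by norm_num)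
  have hq1 : 1 / q ≤ 1 := (div_le_one (by linarith)).mpr hq
  rcases le_total (Real.log n) 1 with h | h
  · have := Real.rpow_le_one hlog h (by positivity : 0 ≤ 1 / q)
    linarith
  · have h2 := Real.rpow_le_rpow_of_exponent_le h hq1
    rw [Real.rpow_one] at h2
    have h3 := Real.log_le_rpow_div (by linarith : 0 ≤ n) (by norm_num : (0 : ℝ) < 1 / 8)
    linarith

/-- The stochastic error of the M-estimator, of squared size `1 / (n δ lam²)`. -/
lemma stochastic_error_le {n q m δ A : ℝ} (hn : 2 ≤ n) (hq : 1 ≤ q) (hm : 0 < m)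
    (hδ : 2 * Real.log n ^ (-(1 / q)) * m ≤ δ) :
    16 * A ^ 2 / (n * δ * (n ^ (-(1 / (4 * q)))) ^ 2) ≤
      (8 * A / Real.sqrt m * n ^ (-(3 / 16) : ℝ)) ^ 2 := by
  have hn0 : 0 < n := by linarith
  have hlog : 0 < Real.log n := Real.log_pos (by linarith)
  have hn1 : 1 ≤ n := by linarith
  have hpow : n ^ (1 / 2 : ℝ) ≤ n * (n ^ (-(1 / (4 * q)))) ^ 2 := by
    have h1 : n * (n ^ (-(1 / (4 * q)))) ^ 2 = n ^ (1 - 1 / (2 * q)) := by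
      rw [← Real.rpow_natCast (n ^ (-(1 / (4 * q)))) 2, ← Real.rpow_mul hn0.le]
      nth_rewrite 1 [← Real.rpow_one n]
      rw [← Real.rpow_add hn0]
      congr 1
      push_cast
      field_simp
      ring
    rw [h1]
    refine Real.rpow_le_rpow_of_exponent_le hn1 ?_
    have : 1 / (2 * q) ≤ 1 / 2 := one_div_le_one_div_of_le (by norm_num) (by linarith)
    linarith
  have hδ' : 2 * m ≤ δ * (8 * n ^ (1 / 8 : ℝ)) := by
    rw [Real.rpow_neg hlog.le] at hδ
    have hl : 0 < Real.log n ^ (1 / q) := Real.rpow_pos_of_pos hlog _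
    have h1 : 2 * m ≤ δ * Real.log n ^ (1 / q) := by
      have := mul_le_mul_of_nonneg_right hδ hl.le
      calc 2 * m = 2 * (Real.log n ^ (1 / q))⁻¹ * m * Real.log n ^ (1 / q) := by field_simp
        _ ≤ _ := this
    have hδ0 : 0 < δ := lt_of_lt_of_le (by positivity) hδ
    exact h1.trans (mul_le_mul_of_nonneg_left (log_rpow_inv_le hn1 hq) hδ0.le)
  have h8 : 0 < n ^ (1 / 8 : ℝ) := Real.rpow_pos_of_pos hn0 _
  have hδ0 : 0 < δ := by
    by_contra h
    have := mul_nonpos_of_nonpos_of_nonneg (not_lt.mp h) (by positivity : 0 ≤ 8 * n ^ (1 / 8 : ℝ))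
    linarith
  have hden : m * n ^ (3 / 8 : ℝ) / 4 ≤ n * δ * (n ^ (-(1 / (4 * q)))) ^ 2 := by
    have h2 : n ^ (1 / 2 : ℝ) = n ^ (3 / 8 : ℝ) * n ^ (1 / 8 : ℝ) := by
      rw [← Real.rpow_add hn0]; norm_num
    have h3 : 0 ≤ n ^ (3 / 8 : ℝ) := (Real.rpow_pos_of_pos hn0 _).le
    calc _ = n ^ (3 / 8 : ℝ) * (2 * m) / 8 := by ring
      _ ≤ n ^ (3 / 8 : ℝ) * (δ * (8 * n ^ (1 / 8 : ℝ))) / 8 := by gcongr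
      _ = δ * n ^ (1 / 2 : ℝ) := by rw [h2]; ring
      _ ≤ δ * (n * (n ^ (-(1 / (4 * q)))) ^ 2) := mul_le_mul_of_nonneg_left hpow hδ0.le
      _ = _ := by ring
  have h38 : (n ^ (-(3 / 16) : ℝ)) ^ 2 = (n ^ (3 / 8 : ℝ))⁻¹ := by
    rw [← Real.rpow_natCast (n ^ (-(3 / 16) : ℝ)) 2, ← Real.rpow_mul hn0.le, ← Real.rpow_neg hn0.le]
    norm_num
  have h3 : 0 < n ^ (3 / 8 : ℝ) := Real.rpow_pos_of_pos hn0 _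
  rw [mul_pow, div_pow, Real.sq_sqrt hm.le, h38]
  calc _ ≤ 16 * A ^ 2 / (m * n ^ (3 / 8 : ℝ) / 4) :=
        div_le_div_of_nonneg_left (by positivity) (by positivity) hden
    _ = _ := by field_simp; ring

/-- The estimate itself produces no factor `(log n) ^ (q / 2)`. Inserting it costs only a constant,
because `log n ≥ log 2` and `log 2 < 1`. -/
lemma max_rpow_le {n q r : ℝ} (hn : 2 ≤ n) (hq : 1 ≤ q) :
    max (n ^ (-(3 / 16) : ℝ)) (n ^ (-r)) ≤
      Real.log 2 ^ (-(q / 2)) * max (Real.log n ^ (q / 2) * n ^ (-(3 / 16) : ℝ)) (n ^ (-r)) := by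
  have hlog2 : 0 < Real.log 2 := Real.log_pos one_lt_two
  have hn0 : 0 < n := by linarith
  rw [Real.rpow_neg hlog2.le, le_inv_mul_iff₀ (Real.rpow_pos_of_pos hlog2 _),
    mul_max_of_nonneg _ _ (Real.rpow_nonneg hlog2.le _)]
  refine max_le_max ?_ ?_
  · refine mul_le_mul_of_nonneg_right ?_ (Real.rpow_nonneg hn0.le _)
    exact Real.rpow_le_rpow hlog2.le (Real.log_le_log two_pos hn) (by positivity)
  · refine mul_le_of_le_one_left (Real.rpow_nonneg hn0.le _) ?_
    exact Real.rpow_le_one hlog2.le (by linarith [Real.log_two_lt_d9]) (by positivity)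

end Rates

end SparseRKHS

/-! ### Assembly of the bound -/

theorem theorem1
    (q c₁ : ℝ) (c₂ : ℝ → ℝ) (κ₁ κ₂ c₃ θ B m : ℝ)
    (hq : 1 ≤ q) (hc₁ : 0 < c₁) (hc₂ : ∀ R : ℝ, 0 ≤ R → 0 < c₂ R)
    (hκ₁ : 0 < κ₁) (hκ₂ : 0 < κ₂) (hc₃ : 0 < c₃) (hθ : 0 < θ) :
    ∃ c₄ : ℝ, 0 < c₄ ∧
      ∀ (n : ℕ), 2 ≤ n →
      ∀ (p : ℕ) (X : Set (SparseRKHS.E p)), IsCompact X → X ⊆ closure (interior X) →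
      ∀ (Y : Set ℝ) (L : Y → ℝ → ℝ), SparseRKHS.LossConditions q c₁ c₂ L →
      ∀ (P : Measure (X × Y)) [IsProbabilityMeasure P],
        Integrable (fun z : X × Y => |(z.2 : ℝ)|) P →
        ∫ z : X × Y, |(z.2 : ℝ)| ∂P = m →
      ∀ (H : Type*) [NormedAddCommGroup H] [InnerProductSpace ℝ H] [CompleteSpace H]
        [RKHS ℝ H X ℝ],
        (∀ y : X, SparseRKHS.IsC1 (fun x : X => SparseRKHS.kerSection H y x)) →
        SparseRKHS.KernelBounds H κ₁ κ₂ →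
      ∀ (fstar ftilde : H) (fhat : (Fin n → X × Y) → H),
        SparseRKHS.IsTarget P L fstar →
        ‖fstar‖ ≤ B →
        SparseRKHS.IsRegRiskMinimizer P L ((n : ℝ) ^ (-(1 / (4 * q)))) ftilde →
        ‖ftilde - fstar‖ = c₃ * ((n : ℝ) ^ (-(1 / (4 * q)))) ^ θ →
        (∀ z, SparseRKHS.IsMEstimator L ((n : ℝ) ^ (-(1 / (4 * q)))) z (fhat z)) →
      ∀ δ : ℝ, 2 * Real.log n ^ (-(1 / q)) * m ≤ δ →
        Measure.pi (fun _ : Fin n => P)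
          {z | ¬ ∀ l : Fin p,
            |SparseRKHS.empNormSq z (SparseRKHS.partialDeriv l (fhat z)) -
                SparseRKHS.popNormSq P (SparseRKHS.partialDeriv l fstar)| ≤
              c₄ * Real.log (4 * p / δ) ^ (1 / 2 : ℝ) *
                max (Real.log n ^ (q / 2) * (n : ℝ) ^ (-(3 / 16) : ℝ))
                  ((n : ℝ) ^ (-(θ / (4 * q))))}
          ≤ ENNReal.ofReal δ := by
  have hlog2 : 0 < Real.log 2 := Real.log_pos one_lt_two
  -- `|B| + c₃` bounds `‖ftilde‖` because `lam ≤ 1`; thus `R` is independent of `n`.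
  set R : ℝ := κ₁ * (|B| + c₃) + 1 with hR
  have hR0 : 0 ≤ R := by positivity
  have hC0 : 0 < c₂ R := hc₂ R hR0
  -- The factor `1 / √m` comes from the lower bound on `δ`. For `m ≤ 0` it takes the default value
  -- `0`, harmlessly: the hypotheses force `m > 0`.
  set a : ℝ := 8 * (c₂ R * κ₁) / Real.sqrt m with ha
  have ha0 : 0 ≤ a := by positivity
  set b : ℝ := κ₂ * |B| + 1 with hb
  have hb0 : 0 < b := by positivity
  set G : ℝ := κ₂ ^ 2 * ((a + c₃) * (2 * |B| + (a + c₃))) with hG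
  have hG0 : 0 ≤ G := by positivity
  refine ⟨(G + b ^ 2) * Real.log 2 ^ (-(q / 2)), by positivity, ?_⟩
  intro n hn p X _ hX Y L hL P _ hint hmean H _ _ _ _ hC hK fstar ftilde fhat hstar hB htilde
    hbias hhat δ hδ
  have hnR : (2 : ℝ) ≤ n := by exact_mod_cast hn
  have hn0 : (0 : ℝ) < n := by linarith
  have hn1 : (1 : ℝ) ≤ n := by linarith
  have hnpos : 0 < n := by omega
  set lam : ℝ := (n : ℝ) ^ (-(1 / (4 * q))) with hlam
  have hlam0 : 0 < lam := Real.rpow_pos_of_pos hn0 _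
  have hlam1 : lam ≤ 1 := Real.rpow_le_one_of_one_le_of_nonpos hn1 (by
    have : 0 ≤ 1 / (4 * q) := by positivity
    linarith)
  have hm : 0 < m := by
    rw [← hmean]
    refine SparseRKHS.integral_abs_response_pos hL hq hint hlam0 hstar htilde ?_
    rw [hbias]
    positivity
  have hlogn : 0 < Real.log n := Real.log_pos (by linarith)
  have hδ0 : 0 < δ := lt_of_lt_of_le (by positivity) hδ
  rcases le_or_gt 1 δ with hδ1 | hδ1
  · exact prob_le_one.trans (by simpa using ENNReal.ofReal_le_ofReal hδ1)
  rcases Nat.eq_zero_or_pos p with rfl | hp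
  · simp
  have hpR : (1 : ℝ) ≤ p := by exact_mod_cast hp
  set Λ : ℝ := Real.log (4 * p / δ) with hΛ
  have hratio : 4 ≤ 4 * p / δ := by
    rw [le_div_iff₀ hδ0]
    nlinarith
  have hΛ1 : 1 ≤ Λ := by
    have h4 : Real.log 4 = 2 * Real.log 2 := by
      rw [show (4 : ℝ) = 2 ^ 2 by norm_num, Real.log_pow]; norm_num
    have := Real.log_le_log (by norm_num) hratio
    linarith [Real.log_two_gt_d9]
  set M : ℝ := max ((n : ℝ) ^ (-(3 / 16) : ℝ)) ((n : ℝ) ^ (-(θ / (4 * q)))) with hM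
  have hM0 : 0 ≤ M := (Real.rpow_nonneg hn0.le _).trans (le_max_left _ _)
  have hM1 : M ≤ 1 := max_le (Real.rpow_le_one_of_one_le_of_nonpos hn1 (by norm_num))
    (Real.rpow_le_one_of_one_le_of_nonpos hn1 (by
      have : 0 ≤ θ / (4 * q) := by positivity
      linarith))
  have hlamθ : lam ^ θ = (n : ℝ) ^ (-(θ / (4 * q))) := by
    rw [hlam, ← Real.rpow_mul hn0.le]
    congr 1
    ring
  have hBabs : ‖fstar‖ ≤ |B| := hB.trans (le_abs_self B)
  have hftilde : ‖ftilde‖ ≤ |B| + c₃ := by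
    have h1 : c₃ * lam ^ θ ≤ c₃ :=
      mul_le_of_le_one_right hc₃.le (Real.rpow_le_one hlam0.le hlam1 hθ.le)
    have h2 := norm_le_norm_add_norm_sub fstar ftilde
    rw [norm_sub_rev, hbias] at h2
    linarith
  have hfin : SparseRKHS.risk P L ftilde ≠ ⊤ := by
    have h := htilde fstar
    refine ne_top_of_le_ne_top ?_ ((self_le_add_right _ _).trans h)
    exact ENNReal.add_ne_top.mpr ⟨hstar.1.1, ENNReal.ofReal_ne_top⟩
  -- `ρ` and `t` are chosen so that the Chebyshev and Hoeffding events each have probability at most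
  -- `δ / 2`.
  set ρ : ℝ := 16 * (c₂ R * κ₁) ^ 2 / (n * δ * lam ^ 2) with hρ
  have hρ0 : 0 < ρ := by positivity
  set t : ℝ := b ^ 2 * Real.sqrt (Λ / (2 * n)) with ht
  have ht0 : 0 ≤ t := by positivity
  have hE1 := SparseRKHS.measure_norm_sub_sq_ge_le (P := P) hL hK hC hlam0 hfin htilde
    (R := R) (by rw [hR]; gcongr) hC0 hnpos hhat hρ0
  have hE2 := hK.measure_abs_empNormSq_sub_popNormSq_ge_le (P := P) hX hC fstar hb0
    (by rw [hb]; nlinarith) hnpos ht0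
  have hp1 : 8 * (c₂ R * κ₁) ^ 2 / (n * lam ^ 2 * ρ) = δ / 2 := by
    rw [hρ]; field_simp; norm_num
  have hp2 : p * (2 * Real.exp (-(2 * n * t ^ 2 / (b ^ 2) ^ 2))) = δ / 2 := by
    have h1 : 2 * n * t ^ 2 / (b ^ 2) ^ 2 = Λ := by
      rw [ht, mul_pow, Real.sq_sqrt (by positivity)]
      field_simp
    rw [h1, Real.exp_neg, hΛ, Real.exp_log (by linarith)]
    field_simp
    norm_num
  rw [hp1] at hE1
  rw [hp2] at hE2
  have hsum : ENNReal.ofReal (δ / 2) + ENNReal.ofReal (δ / 2) = ENNReal.ofReal δ := by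
    rw [← ENNReal.ofReal_add (by positivity) (by positivity), add_halves]
  rw [← hsum]
  refine (measure_mono fun z hz => ?_).trans ((measure_union_le _ _).trans (add_le_add hE1 hE2))
  by_contra hnot
  rw [Set.mem_union, not_or, Set.mem_ofPred_eq, Set.mem_ofPred_eq, not_le, not_exists] at hnot
  refine hz fun l => ?_
  have hr : ‖fhat z - ftilde‖ ≤ a * (n : ℝ) ^ (-(3 / 16) : ℝ) := by
    refine le_of_sq_le_sq ?_ (by positivity)
    exact hnot.1.le.trans (SparseRKHS.stochastic_error_le hnR hq hm hδ)
  have hr' : ‖fhat z - fstar‖ ≤ (a + c₃) * M := by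
    have h1 := norm_sub_le_norm_sub_add_norm_sub (fhat z) ftilde fstar
    rw [hbias, hlamθ] at h1
    have h2 : a * (n : ℝ) ^ (-(3 / 16) : ℝ) ≤ a * M :=
      mul_le_mul_of_nonneg_left (le_max_left _ _) ha0
    have h3 : c₃ * (n : ℝ) ^ (-(θ / (4 * q))) ≤ c₃ * M :=
      mul_le_mul_of_nonneg_left (le_max_right _ _) hc₃.le
    linarith
  have hnorms : ‖fhat z‖ + ‖fstar‖ ≤ 2 * |B| + (a + c₃) := by
    have h1 := norm_le_norm_add_norm_sub fstar (fhat z)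
    rw [norm_sub_rev] at h1
    have h2 : (a + c₃) * M ≤ a + c₃ := mul_le_of_le_one_right (by positivity) hM1
    linarith
  have hfirst : |SparseRKHS.empNormSq z (SparseRKHS.partialDeriv l (fhat z)) -
      SparseRKHS.empNormSq z (SparseRKHS.partialDeriv l fstar)| ≤ G * M := by
    refine (hK.abs_empNormSq_sub_le hX hC l (fhat z) fstar hnpos z).trans ?_
    calc _ ≤ κ₂ ^ 2 * (((a + c₃) * M) * (2 * |B| + (a + c₃))) := by gcongr
      _ = G * M := by rw [hG]; ring
  -- This lets the term `G * M`, which carries no logarithm, be absorbed into the common factor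
  -- `√Λ`.
  have hsqrtΛ : 1 ≤ Real.sqrt Λ := Real.one_le_sqrt.mpr hΛ1
  have htM : t ≤ b ^ 2 * (Real.sqrt Λ * M) := by
    refine mul_le_mul_of_nonneg_left ?_ (by positivity)
    rw [Real.sqrt_div' _ (by positivity), div_eq_mul_inv]
    refine mul_le_mul_of_nonneg_left ?_ (Real.sqrt_nonneg _)
    calc (Real.sqrt (2 * n))⁻¹ ≤ (Real.sqrt n)⁻¹ :=
          inv_anti₀ (Real.sqrt_pos.mpr hn0) (Real.sqrt_le_sqrt (by linarith))
      _ = (n : ℝ) ^ (-(1 / 2) : ℝ) := by rw [Real.sqrt_eq_rpow, ← Real.rpow_neg hn0.le]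
      _ ≤ (n : ℝ) ^ (-(3 / 16) : ℝ) := Real.rpow_le_rpow_of_exponent_le hn1 (by norm_num)
      _ ≤ M := le_max_left _ _
  have hsecond := (not_le.mp (hnot.2 l)).le
  have htri := abs_sub_le (SparseRKHS.empNormSq z (SparseRKHS.partialDeriv l (fhat z)))
    (SparseRKHS.empNormSq z (SparseRKHS.partialDeriv l fstar))
    (SparseRKHS.popNormSq P (SparseRKHS.partialDeriv l fstar))
  rw [← Real.sqrt_eq_rpow]
  calc _ ≤ G * M + b ^ 2 * (Real.sqrt Λ * M) := by linarith
    _ ≤ G * (Real.sqrt Λ * M) + b ^ 2 * (Real.sqrt Λ * M) := by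
        gcongr
        exact le_mul_of_one_le_left hM0 hsqrtΛ
    _ = (G + b ^ 2) * Real.sqrt Λ * M := by ring
    _ ≤ (G + b ^ 2) * Real.sqrt Λ * (Real.log 2 ^ (-(q / 2)) * _) :=
        mul_le_mul_of_nonneg_left (SparseRKHS.max_rpow_le hnR hq) (by positivity)
    _ = _ := by ring
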